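/- Let $M$ be a von Neumann algebra, that is, a $*$-subalgebra of the bounded operators on a complex Hilbert space $H$ that equals its own double commutant. Assume that $M$ has zero commutative summand, i.e. the only central projection $z\in M$ for which $zM$ is commutative is $z=0$. Let $I\subseteq M$ be a (not necessarily closed) two-sided ideal. For $s>0$ let $I^{s}\subseteq M$ denote the complex linear span of $\{a^{s} : a\in I,\ a\ge 0\}$, where $a^s$ is formed by continuous functional calculus (this is the unique two-sided ideal of $M$ that is spanned by its positive elements and whose positive elements are exactly the $a^s$ with $0\le a\in I$). For linear subspaces $V,W\subseteq M$ let $[V,W]$ denote the linear span of all commutators $xy-yx$ with $x\in V$, $y\in W$, and let $V^2$ denote the linear span of all products $xy$ with $x,y\in V$. Then $$I=\bigl[M,I^{1/2}\bigr]^2=\bigl[I^{1/4},I^{1/4}\bigr]^2,$$ and $$[M,I]\subseteq\bigl[[M,I^{1/2}],[M,I^{1/2}]\bigr]\subseteq\bigl[[I^{1/4},I^{1/4}],[I^{1/4},I^{1/4}]\bigr]\subseteq[I^{1/2},I^{1/2}].$$ -/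

import Mathlib

/-- A von Neumann algebra `M` is closed under real powers `a ^ s` (formed by the
continuous functional calculus of bounded operators). -/
theorem VonNeumannAlgebra.rpow_mem_toStarSubalgebra {H : Type*} [NormedAddCommGroup H]
    [InnerProductSpace ℂ H] [CompleteSpace H] (M : VonNeumannAlgebra H) {a : H →L[ℂ] H}
    (ha : a ∈ M.toStarSubalgebra) (s : ℝ) : a ^ s ∈ M.toStarSubalgebra := by
  have ha' : a ∈ M := ha
  change a ^ s ∈ M
  rw [← M.commutant_commutant, VonNeumannAlgebra.mem_commutant_iff]
  intro g hg
  have hc : Commute a g := VonNeumannAlgebra.mem_commutant_iff.1 hg a ha'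
  exact (hc.cfc_nnreal (fun x : NNReal => x ^ s)).symm

/-- `M` has zero commutative summand: the only central projection `z` of `M` for which the direct
summand `zM` is commutative is `z = 0`. -/
def VonNeumannAlgebra.ZeroCommutativeSummand {H : Type*} [NormedAddCommGroup H]
    [InnerProductSpace ℂ H] [CompleteSpace H] (M : VonNeumannAlgebra H) : Prop :=
  ∀ z : M.toStarSubalgebra, IsStarProjection z → (∀ x, z * x = x * z) →
    (∀ x y, (z * x) * (z * y) = (z * y) * (z * x)) → z = 0

/-- A two-sided ideal of a unital complex algebra, viewed as a linear subspace. -/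
def TwoSidedIdeal.toSubspace {A : Type*} [Ring A] [Algebra ℂ A] (I : TwoSidedIdeal A) :
    Submodule ℂ A :=
  (TwoSidedIdeal.asIdeal I).restrictScalars ℂ

/-- `[V, W]`: the linear span of all commutators `[x, y] = x * y - y * x` with `x ∈ V`, `y ∈ W`. -/
def commutatorSpan {A : Type*} [Ring A] [Algebra ℂ A] (V W : Submodule ℂ A) : Submodule ℂ A :=
  Submodule.span ℂ {c | ∃ x ∈ V, ∃ y ∈ W, c = x * y - y * x}

/-- The power `I ^ s` of a two-sided ideal `I` of a von Neumann algebra `M`, for `s > 0`: the linear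
span of the operators `a ^ s`, where `a` runs through the positive elements of `I`. (The ideal with
positive part `{a ^ s | a ∈ I, 0 ≤ a}` is spanned by its positive part, hence is this subspace.)
An element of `M` is positive if and only if it is a positive operator on `H`. -/
noncomputable def VonNeumannAlgebra.idealPow {H : Type*} [NormedAddCommGroup H]
    [InnerProductSpace ℂ H] [CompleteSpace H] (M : VonNeumannAlgebra H)
    (I : TwoSidedIdeal M.toStarSubalgebra) (s : ℝ) : Submodule ℂ M.toStarSubalgebra :=
  Submodule.span ℂ {b | ∃ a ∈ I, 0 ≤ (a : H →L[ℂ] H) ∧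
    b = ⟨(a : H →L[ℂ] H) ^ s, M.rpow_mem_toStarSubalgebra a.2 s⟩}

/-- Consistency of `idealPow`: a two-sided ideal `J` that is spanned by its positive elements, and
whose positive elements are exactly the `a ^ s` with `0 ≤ a ∈ I`, is `M.idealPow I s`. -/
theorem VonNeumannAlgebra.eq_idealPow_of_positive_part {H : Type*} [NormedAddCommGroup H]
    [InnerProductSpace ℂ H] [CompleteSpace H] (M : VonNeumannAlgebra H)
    (I J : TwoSidedIdeal M.toStarSubalgebra) (s : ℝ)
    (hspan : J.toSubspace =
      Submodule.span ℂ {b : M.toStarSubalgebra | b ∈ J ∧ 0 ≤ (b : H →L[ℂ] H)})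
    (hpos : ∀ b : M.toStarSubalgebra, (b ∈ J ∧ 0 ≤ (b : H →L[ℂ] H)) ↔
      ∃ a ∈ I, 0 ≤ (a : H →L[ℂ] H) ∧ (b : H →L[ℂ] H) = (a : H →L[ℂ] H) ^ s) :
    J.toSubspace = M.idealPow I s := by
  rw [hspan, VonNeumannAlgebra.idealPow]
  congr 1
  ext b
  simp only [Set.mem_ofPred_eq, hpos, Subtype.ext_iff]

/-! Put `J = I^{1/2}` and `K = I^{1/4}`. Since `K * K = J` and `J * J = I`, the identity `[x, ab] =
[xa, b] + [bx, a]` gives `[M, J] ⊆ [K, K] ⊆ J`, so everything reduces to `I ⊆ [M, J]^2` and `[M, I]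
⊆ [[M, J], [M, J]]`.

Absence of a commutative summand is used only to split `1 = p + q + r`, with `p = v v*` equivalent
to `q = v* v` and `r` equivalent to a subprojection of `p` (`exists_halvingFrame`). Here `v` is a
maximal partial isometry of square zero. The remaining corner `rMr` then has no nonzero element of
square zero, and a part of `r` not absorbed by `p` would have central support below `r`. That
support would cut out a summand without square-zero elements, hence a commutative one.

Given such a frame, a subspace `W` stable under commutators with `M` contains `[M, I]` as soon as it
contains the single corner `v I v = pIq`, and contains `I` if it also contains `v I v* = pIp`
(`commutatorSpan_top_le`, `toSubspace_le`). The positive elements of `pIp` span it and are squares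
`h^2` with `h ∈ J` and `h = php`. Both hypotheses are then explicit: `a = h - v* h v` and `b = h v`
lie in `[M, J]`, and `ab = h^2 v = -ba`, while `h^2 = (h v)(v* h)`.

The ideal theory rests on factorizations inside `M`: Douglas factorization makes `{x | x* x ∈ I}` an
ideal, and polar decomposition makes ideals self-adjoint and spanned by their positive elements. -/

/-! ### Commutators in a ring with a halving frame. -/

section LieIdeals

variable {A : Type*} [Ring A]

/-- Elements `v, v', u, u'` of a ring such that `p = v * v'`, `q = v' * v`, `r = u' * u` are
orthogonal idempotents with sum `1`, where `p` and `q` are equivalent and `r` is equivalent to an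
idempotent below `p`. -/
structure HalvingFrame (A : Type*) [Ring A] where
  (v v' u u' : A)
  v_v : v * v = 0
  v'_v' : v' * v' = 0
  v_u : v * u = 0
  u_v : u * v = 0
  u_v' : u * v' = 0
  u'_v' : u' * v' = 0
  v_u' : v * u' = 0
  v'_u' : v' * u' = 0
  u_u : u * u = 0
  u'_u' : u' * u' = 0
  v_v'_v : v * (v' * v) = v
  v'_v_v' : v' * (v * v') = v'
  v_v'_u : v * (v' * u) = u
  u'_v_v' : u' * (v * v') = u'
  u_u'_u : u * (u' * u) = u
  u'_u_u' : u' * (u * u') = u'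
  sum_eq_one : v * v' + v' * v + u' * u = 1

namespace HalvingFrame

variable (F : HalvingFrame A)

theorem mul_zero_assoc {a b : A} (h : a * b = 0) (x : A) : a * (b * x) = 0 := by
  rw [← mul_assoc, h, zero_mul]

theorem mul_mul_assoc {a b c d : A} (h : a * (b * c) = d) (x : A) : a * (b * (c * x)) = d * x := by
  rw [← h]; simp only [mul_assoc]

theorem a_v_v (x : A) : F.v * (F.v * x) = 0 := mul_zero_assoc F.v_v x
theorem a_v'_v' (x : A) : F.v' * (F.v' * x) = 0 := mul_zero_assoc F.v'_v' x
theorem a_v_u (x : A) : F.v * (F.u * x) = 0 := mul_zero_assoc F.v_u x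
theorem a_u_v (x : A) : F.u * (F.v * x) = 0 := mul_zero_assoc F.u_v x
theorem a_u_v' (x : A) : F.u * (F.v' * x) = 0 := mul_zero_assoc F.u_v' x
theorem a_u'_v' (x : A) : F.u' * (F.v' * x) = 0 := mul_zero_assoc F.u'_v' x
theorem a_v_u' (x : A) : F.v * (F.u' * x) = 0 := mul_zero_assoc F.v_u' x
theorem a_v'_u' (x : A) : F.v' * (F.u' * x) = 0 := mul_zero_assoc F.v'_u' x
theorem a_u_u (x : A) : F.u * (F.u * x) = 0 := mul_zero_assoc F.u_u x
theorem a_u'_u' (x : A) : F.u' * (F.u' * x) = 0 := mul_zero_assoc F.u'_u' x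
theorem a_v_v'_v (x : A) : F.v * (F.v' * (F.v * x)) = F.v * x := mul_mul_assoc F.v_v'_v x
theorem a_v'_v_v' (x : A) : F.v' * (F.v * (F.v' * x)) = F.v' * x := mul_mul_assoc F.v'_v_v' x
theorem a_v_v'_u (x : A) : F.v * (F.v' * (F.u * x)) = F.u * x := mul_mul_assoc F.v_v'_u x
theorem a_u'_v_v' (x : A) : F.u' * (F.v * (F.v' * x)) = F.u' * x := mul_mul_assoc F.u'_v_v' x
theorem a_u_u'_u (x : A) : F.u * (F.u' * (F.u * x)) = F.u * x := mul_mul_assoc F.u_u'_u x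
theorem a_u'_u_u' (x : A) : F.u' * (F.u * (F.u' * x)) = F.u' * x := mul_mul_assoc F.u'_u_u' x

theorem eq_sum (F : HalvingFrame A) (x : A) :
    x = F.v * (F.v' * x) + F.v' * (F.v * x) + F.u' * (F.u * x) := by
  conv_lhs => rw [← one_mul x, ← F.sum_eq_one]
  simp only [add_mul, mul_assoc]

theorem v_mul_eq_zero {F : HalvingFrame A} {h : A} (h1 : F.v * F.v' * h = h) : F.v * h = 0 := by
  rw [← h1, mul_assoc, a_v_v]

theorem mul_v'_eq_zero {F : HalvingFrame A} {h : A} (h2 : h * (F.v * F.v') = h) : h * F.v' = 0 := by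
  rw [← h2]; simp only [mul_assoc, v'_v', mul_zero]

end HalvingFrame

variable [Algebra ℂ A]

theorem mem_toSubspace {I : TwoSidedIdeal A} {x : A} : x ∈ I.toSubspace ↔ x ∈ I := by
  simp [TwoSidedIdeal.toSubspace, TwoSidedIdeal.mem_asIdeal]

theorem commutator_mem_commutatorSpan {V W : Submodule ℂ A} {x y : A} (hx : x ∈ V) (hy : y ∈ W) :
    x * y - y * x ∈ commutatorSpan V W :=
  Submodule.subset_span ⟨x, hx, y, hy, rfl⟩

theorem commutatorSpan_mono {V V' W W' : Submodule ℂ A} (hV : V ≤ V') (hW : W ≤ W') :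
    commutatorSpan V W ≤ commutatorSpan V' W' := by
  refine Submodule.span_mono ?_
  rintro _ ⟨x, hx, y, hy, rfl⟩
  exact ⟨x, hV hx, y, hW hy, rfl⟩

theorem commutatorSpan_le {V W U : Submodule ℂ A}
    (h : ∀ x ∈ V, ∀ y ∈ W, x * y - y * x ∈ U) : commutatorSpan V W ≤ U := by
  refine Submodule.span_le.2 ?_
  rintro _ ⟨x, hx, y, hy, rfl⟩
  exact h x hx y hy

/-- A subspace `W` with `[A, W] ⊆ W`. -/
def Submodule.IsLieStable (W : Submodule ℂ A) : Prop :=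
  ∀ x : A, ∀ w ∈ W, x * w - w * x ∈ W

theorem TwoSidedIdeal.isLieStable_toSubspace (I : TwoSidedIdeal A) :
    I.toSubspace.IsLieStable := by
  intro x w hw
  rw [mem_toSubspace] at *
  exact I.sub_mem (I.mul_mem_left _ _ hw) (I.mul_mem_right _ _ hw)

theorem Submodule.isLieStable_top : (⊤ : Submodule ℂ A).IsLieStable :=
  fun _ _ _ => Submodule.mem_top

theorem Submodule.IsLieStable.commutatorSpan {V W : Submodule ℂ A} (hV : V.IsLieStable)
    (hW : W.IsLieStable) : (commutatorSpan V W).IsLieStable := by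
  intro x w hw
  refine Submodule.span_induction (p := fun w _ => x * w - w * x ∈ _root_.commutatorSpan V W)
    ?_ ?_ ?_ ?_ hw
  · rintro _ ⟨a, ha, b, hb, rfl⟩
    have h1 := commutator_mem_commutatorSpan (hV x a ha) hb
    have h2 := commutator_mem_commutatorSpan ha (hW x b hb)
    convert add_mem h1 h2 using 1
    noncomm_ring
  · simp
  · intro a b _ _ ha hb
    convert add_mem ha hb using 1
    noncomm_ring
  · intro c a _ ha
    convert Submodule.smul_mem _ c ha using 1
    simp [smul_sub]

theorem Submodule.IsLieStable.pow_two {W : Submodule ℂ A} (hW : W.IsLieStable) :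
    (W ^ 2).IsLieStable := by
  intro x w hw
  rw [_root_.pow_two] at hw ⊢
  refine Submodule.mul_induction_on hw ?_ ?_
  · intro a ha b hb
    have h1 := Submodule.mul_mem_mul (hW x a ha) hb
    have h2 := Submodule.mul_mem_mul ha (hW x b hb)
    convert add_mem h1 h2 using 1
    noncomm_ring
  · intro a b ha hb
    convert add_mem ha hb using 1
    noncomm_ring

/-! ### Lie-stable subspaces containing one off-diagonal corner of an ideal. -/

namespace HalvingFrame

attribute [local simp] v_v v'_v' v_u u_v u_v' u'_v' v_u' v'_u' u_u u'_u' v_v'_v v'_v_v' v_v'_u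
  u'_v_v' u_u'_u u'_u_u' a_v_v a_v'_v' a_v_u a_u_v a_u_v' a_u'_v' a_v_u' a_v'_u' a_u_u a_u'_u'
  a_v_v'_v a_v'_v_v' a_v_v'_u a_u'_v_v' a_u_u'_u a_u'_u_u' mul_assoc sub_mul mul_sub add_mul mul_add

variable {F : HalvingFrame A} {W : Submodule ℂ A} {I : TwoSidedIdeal A}

/-- Because `v' * v' = 0`, the double commutator `[v', [v', x]]` is `-2 v' x v'`; taking `x = v v' z
v' v` carries the corner `pIq` to `qIp`. This and the next four lemmas place all six off-diagonal
corners of `I` in `W`. -/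
theorem v'_mul_mul_v'_mem (hW : W.IsLieStable) (h : ∀ z ∈ I, F.v * z * F.v ∈ W) {z : A}
    (hz : z ∈ I) : F.v' * z * F.v' ∈ W := by
  have h1 := hW F.v' _ (hW F.v' _ (h (F.v' * z * F.v')
    (I.mul_mem_right _ _ (I.mul_mem_left _ _ hz))))
  have h2 := Submodule.smul_mem W (-1 / 2 : ℂ) h1
  convert h2 using 1
  simp only [mul_assoc, sub_mul, mul_sub, a_v'_v', a_v'_v_v', v'_v_v', v'_v', mul_zero, zero_sub,
    sub_zero]
  module

theorem v_mul_mul_u_mem (hW : W.IsLieStable) (h : ∀ z ∈ I, F.v * z * F.v ∈ W) {z : A}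
    (hz : z ∈ I) : F.v * z * F.u ∈ W := by
  have h1 := hW (F.v' * F.u) _ (h (z * (F.u * F.u')) (I.mul_mem_right _ _ hz))
  rw [← neg_mem_iff]
  convert h1 using 1
  simp

theorem u'_mul_mul_v'_mem (hW : W.IsLieStable) (h : ∀ z ∈ I, F.v * z * F.v ∈ W) {z : A}
    (hz : z ∈ I) : F.u' * z * F.v' ∈ W := by
  have h1 := hW (F.u' * F.v) _ (v'_mul_mul_v'_mem hW h (I.mul_mem_left (F.u * F.u') _ hz))
  convert h1 using 1
  simp

theorem v'_mul_mul_u_mem (hW : W.IsLieStable) (h : ∀ z ∈ I, F.v * z * F.v ∈ W) {z : A}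
    (hz : z ∈ I) : F.v' * z * F.u ∈ W := by
  have h1 := hW F.v' _ (v_mul_mul_u_mem hW h (I.mul_mem_left F.v' _ hz))
  convert h1 using 1
  simp

theorem u'_mul_mul_v_mem (hW : W.IsLieStable) (h : ∀ z ∈ I, F.v * z * F.v ∈ W) {z : A}
    (hz : z ∈ I) : F.u' * z * F.v ∈ W := by
  have h1 := hW F.v _ (u'_mul_mul_v'_mem hW h (I.mul_mem_right _ F.v hz))
  rw [← neg_mem_iff]
  convert h1 using 1
  simp

/-- Write `y = v z v'` as `b v'` with `b = v z v' v` off-diagonal. Then `[v' x, b] = v' x b - y x`,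
and a further commutator with `v'` trades `v' x b` for `p x y`. The missing pieces `q x y` and `r x
y` of `x y` are off-diagonal. The next two lemmas treat the other diagonal corners in the same way.
-/
theorem commutator_v_mul_mul_v'_mem (hW : W.IsLieStable) (h : ∀ z ∈ I, F.v * z * F.v ∈ W) (x : A)
    {z : A} (hz : z ∈ I) : x * (F.v * z * F.v') - (F.v * z * F.v') * x ∈ W := by
  have h1 := hW (F.v' * x) _ (h (z * F.v') (I.mul_mem_right _ _ hz))
  have h2 := hW F.v' _ (h (F.v' * x * F.v * z * F.v')
    (I.mul_mem_right _ _ (I.mul_mem_left _ _ hz)))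
  have h3 := hW F.v' _ (u'_mul_mul_v_mem hW h (z := F.u * x * F.v * z * F.v')
    (I.mul_mem_right _ _ (I.mul_mem_left _ _ hz)))
  have h4 := v'_mul_mul_v'_mem hW h (z := F.v * x * F.v * z) (I.mul_mem_left _ _ hz)
  convert add_mem (sub_mem (sub_mem h1 h2) h3) h4 using 1
  conv_lhs => rw [F.eq_sum (x * (F.v * z * F.v'))]
  simp
  abel

theorem commutator_v'_mul_mul_v_mem (hW : W.IsLieStable) (h : ∀ z ∈ I, F.v * z * F.v ∈ W) (x : A)
    {z : A} (hz : z ∈ I) : x * (F.v' * z * F.v) - (F.v' * z * F.v) * x ∈ W := by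
  have h1 := hW (F.v * x) _ (v'_mul_mul_v'_mem hW h (z := z * F.v) (I.mul_mem_right _ _ hz))
  have h2 := hW F.v _ (v'_mul_mul_v'_mem hW h (z := F.v * x * F.v' * z * F.v)
    (I.mul_mem_right _ _ (I.mul_mem_left _ _ hz)))
  have h3 := hW F.v _ (u'_mul_mul_v'_mem hW h (z := F.u * x * F.v' * z * F.v)
    (I.mul_mem_right _ _ (I.mul_mem_left _ _ hz)))
  have h4 := h (F.v' * x * F.v' * z) (I.mul_mem_left _ _ hz)
  convert add_mem (sub_mem (sub_mem h1 h2) h3) h4 using 1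
  conv_lhs => rw [F.eq_sum (x * (F.v' * z * F.v))]
  simp
  abel

theorem commutator_u'_mul_mul_u_mem (hW : W.IsLieStable) (h : ∀ z ∈ I, F.v * z * F.v ∈ W) (x : A)
    {z : A} (hz : z ∈ I) : x * (F.u' * z * F.u) - (F.u' * z * F.u) * x ∈ W := by
  have h1 := hW (F.u * x) _ (u'_mul_mul_v'_mem hW h (z := z * (F.u * F.u' * F.v))
    (I.mul_mem_right _ _ hz))
  have h2 := hW F.u _ (u'_mul_mul_v'_mem hW h (z := F.u * x * F.u' * z * (F.u * F.u' * F.v))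
    (I.mul_mem_right _ _ (I.mul_mem_left _ _ hz)))
  have h3 := hW F.u _ (v'_mul_mul_v'_mem hW h (z := F.v * x * F.u' * z * (F.u * F.u' * F.v))
    (I.mul_mem_right _ _ (I.mul_mem_left _ _ hz)))
  have h4 := v_mul_mul_u_mem hW h (z := F.v' * x * F.u' * z) (I.mul_mem_left _ _ hz)
  convert add_mem (sub_mem (sub_mem h1 h2) h3) h4 using 1
  conv_lhs => rw [F.eq_sum (x * (F.u' * z * F.u))]
  simp
  abel

/-- Split `z` into its nine corners: the six off-diagonal ones lie in `W`, which is Lie stable, and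
the three diagonal ones are covered by the preceding lemmas. -/
theorem commutatorSpan_top_le (F : HalvingFrame A) (hW : W.IsLieStable)
    (h : ∀ z ∈ I, F.v * z * F.v ∈ W) : commutatorSpan ⊤ I.toSubspace ≤ W := by
  refine commutatorSpan_le fun x _ z hz => ?_
  rw [mem_toSubspace] at hz
  have hm : ∀ a b, a * z * b ∈ I := fun a b => I.mul_mem_right _ _ (I.mul_mem_left _ _ hz)
  have e : z = (F.v * F.v' + F.v' * F.v + F.u' * F.u) * z *
      (F.v * F.v' + F.v' * F.v + F.u' * F.u) := by
    rw [F.sum_eq_one, one_mul, mul_one]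
  have e' : x * z - z * x =
      (x * (F.v * (F.v' * z * F.v) * F.v') - F.v * (F.v' * z * F.v) * F.v' * x) +
      (x * (F.v' * (F.v * z * F.v') * F.v) - F.v' * (F.v * z * F.v') * F.v * x) +
      (x * (F.u' * (F.u * z * F.u') * F.u) - F.u' * (F.u * z * F.u') * F.u * x) +
      (x * (F.v * (F.v' * z * F.v') * F.v) - F.v * (F.v' * z * F.v') * F.v * x) +
      (x * (F.v * (F.v' * z * F.u') * F.u) - F.v * (F.v' * z * F.u') * F.u * x) +
      (x * (F.v' * (F.v * z * F.v) * F.v') - F.v' * (F.v * z * F.v) * F.v' * x) +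
      (x * (F.v' * (F.v * z * F.u') * F.u) - F.v' * (F.v * z * F.u') * F.u * x) +
      (x * (F.u' * (F.u * z * F.v) * F.v') - F.u' * (F.u * z * F.v) * F.v' * x) +
      (x * (F.u' * (F.u * z * F.v') * F.v) - F.u' * (F.u * z * F.v') * F.v * x) := by
    conv_lhs => rw [e]
    noncomm_ring
  rw [e']
  exact add_mem (add_mem (add_mem (add_mem (add_mem (add_mem (add_mem (add_mem
    (commutator_v_mul_mul_v'_mem hW h x (hm _ _))
    (commutator_v'_mul_mul_v_mem hW h x (hm _ _)))
    (commutator_u'_mul_mul_u_mem hW h x (hm _ _)))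
    (hW x _ (h _ (hm _ _))))
    (hW x _ (v_mul_mul_u_mem hW h (hm _ _))))
    (hW x _ (v'_mul_mul_v'_mem hW h (hm _ _))))
    (hW x _ (v'_mul_mul_u_mem hW h (hm _ _))))
    (hW x _ (u'_mul_mul_v'_mem hW h (hm _ _))))
    (hW x _ (u'_mul_mul_v_mem hW h (hm _ _)))

/-- Modulo `[A, I] ⊆ W`, cyclic permutation turns `z = v v' z + v' v z + u' u z` into `v' z v + v z
v' + u z u'`, and each of these terms can be moved into the corner `v I v'`. -/
theorem toSubspace_le (F : HalvingFrame A) (hW : W.IsLieStable)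
    (h : ∀ z ∈ I, F.v * z * F.v ∈ W) (h' : ∀ z ∈ I, F.v * z * F.v' ∈ W) : I.toSubspace ≤ W := by
  intro z hz
  rw [mem_toSubspace] at hz
  have hc : ∀ x, ∀ y ∈ I, x * y - y * x ∈ W := fun x y hy =>
    F.commutatorSpan_top_le hW h (commutator_mem_commutatorSpan Submodule.mem_top
      (mem_toSubspace.2 hy))
  have hm : ∀ a b, a * z * b ∈ I := fun a b => I.mul_mem_right _ _ (I.mul_mem_left _ _ hz)
  have h1 := hc F.v (F.v' * z) (I.mul_mem_left _ _ hz)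
  have h2 := hc F.v' (F.v * z) (I.mul_mem_left _ _ hz)
  have h3 := hc F.u' (F.u * z) (I.mul_mem_left _ _ hz)
  have k1 : F.v' * z * F.v ∈ W := by
    have h1 := hc (F.v') (F.v * (F.v' * z * F.v)) (I.mul_mem_left _ _ (hm _ _))
    have h2 := h' (F.v' * z * F.v) (hm _ _)
    convert add_mem h1 h2 using 1
    simp
  have k2 : F.v * z * F.v' ∈ W := h' z hz
  have k3 : F.u * z * F.u' ∈ W := by
    have h2 := h' (F.v' * F.u * z * (F.u' * F.v)) (hm _ _)
    convert h2 using 1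
    simp
  rw [F.eq_sum z]
  convert add_mem (add_mem (add_mem (add_mem (add_mem h1 h2) h3) k1) k2) k3 using 1
  simp
  abel

/-! ### Squares in a corner as commutators and products of commutators. -/

variable {J : TwoSidedIdeal A}

/-- The squares of the elements of `J` that lie in the corner of `F.v * F.v'`. -/
def cornerSquares (F : HalvingFrame A) (J : TwoSidedIdeal A) : Set A :=
  {b | ∃ h ∈ J, F.v * F.v' * h = h ∧ h * (F.v * F.v') = h ∧ b = h * h}

theorem mul_v_mem_of_mem_span_cornerSquares {b : A}
    (hb : b ∈ Submodule.span ℂ (F.cornerSquares J))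
    (hW : ∀ h ∈ J, F.v * F.v' * h = h → h * (F.v * F.v') = h → h * h * F.v ∈ W) :
    b * F.v ∈ W := by
  induction hb using Submodule.span_induction with
  | mem b hb =>
    obtain ⟨h, hh, h1, h2, rfl⟩ := hb
    exact hW h hh h1 h2
  | zero => simp
  | add a b _ _ ha hb => rw [add_mul]; exact add_mem ha hb
  | smul c a _ ha => rw [smul_mul_assoc]; exact Submodule.smul_mem _ c ha

theorem v_mul_mul_v_mem (hsq : ∀ z ∈ I, F.v * z * F.v' ∈ Submodule.span ℂ (F.cornerSquares J))
    (hW : ∀ h ∈ J, F.v * F.v' * h = h → h * (F.v * F.v') = h → h * h * F.v ∈ W)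
    {z : A} (hz : z ∈ I) : F.v * z * F.v ∈ W := by
  have := mul_v_mem_of_mem_span_cornerSquares (hsq (z * F.v) (I.mul_mem_right _ _ hz)) hW
  convert this using 1
  simp

theorem sub_mem_commutatorSpan {h : A} (hh : h ∈ J) (h1 : F.v * F.v' * h = h) :
    h - F.v' * h * F.v ∈ commutatorSpan ⊤ J.toSubspace := by
  have m1 := commutator_mem_commutatorSpan (V := ⊤) (W := J.toSubspace) (x := F.v)
    Submodule.mem_top (mem_toSubspace.2 (J.mul_mem_left F.v' _ hh))
  rwa [← mul_assoc, h1] at m1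

theorem mul_v_mem_commutatorSpan {h : A} (hh : h ∈ J) (h1 : F.v * F.v' * h = h) :
    h * F.v ∈ commutatorSpan ⊤ J.toSubspace := by
  have m2 := commutator_mem_commutatorSpan (V := ⊤) (W := J.toSubspace) (x := F.v * F.v')
    Submodule.mem_top (mem_toSubspace.2 (J.mul_mem_right _ F.v hh))
  rw [← mul_assoc, h1] at m2
  simpa using m2

theorem v'_mul_mem_commutatorSpan {h : A} (hh : h ∈ J) (h2 : h * (F.v * F.v') = h) :
    F.v' * h ∈ commutatorSpan ⊤ J.toSubspace := by
  have m2 := commutator_mem_commutatorSpan (V := ⊤) (W := J.toSubspace) (x := F.v' * F.v)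
    Submodule.mem_top (mem_toSubspace.2 (J.mul_mem_left F.v' _ hh))
  have h4 : h * (F.v' * F.v) = 0 := by rw [← mul_assoc, mul_v'_eq_zero h2, zero_mul]
  simpa [h4] using m2

/-- For `h = p h` one has `v h = 0`. Hence `a = h - v' h v = [v, v' h]` and `b = h v = [v v', h v]`
satisfy `ab = h^2 v` and `ba = -h^2 v`, so that `h^2 v = [a, b] / 2`. -/
theorem commutatorSpan_top_le_commutatorSpan
    (hsq : ∀ z ∈ I, F.v * z * F.v' ∈ Submodule.span ℂ (F.cornerSquares J)) :
    commutatorSpan ⊤ I.toSubspace ≤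
      commutatorSpan (commutatorSpan ⊤ J.toSubspace) (commutatorSpan ⊤ J.toSubspace) := by
  have hL : (commutatorSpan ⊤ J.toSubspace).IsLieStable :=
    Submodule.isLieStable_top.commutatorSpan J.isLieStable_toSubspace
  refine F.commutatorSpan_top_le (hL.commutatorSpan hL) fun z hz => ?_
  refine v_mul_mul_v_mem hsq (fun h hh h1 h2 => ?_) hz
  have m3 := Submodule.smul_mem _ (1 / 2 : ℂ) (commutator_mem_commutatorSpan
    (sub_mem_commutatorSpan hh h1) (mul_v_mem_commutatorSpan hh h1))
  convert m3 using 1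
  have h3 : h * F.v * (h - F.v' * h * F.v) = -(h * h * F.v) := by
    calc h * F.v * (h - F.v' * h * F.v) = h * (F.v * h) - h * (F.v * F.v' * h) * F.v := by
          noncomm_ring
      _ = _ := by rw [v_mul_eq_zero h1, h1]; simp
  have h4 : (h - F.v' * h * F.v) * (h * F.v) = h * h * F.v := by
    calc (h - F.v' * h * F.v) * (h * F.v) = h * h * F.v - F.v' * h * (F.v * h) * F.v := by
          noncomm_ring
      _ = _ := by rw [v_mul_eq_zero h1]; simp
  rw [h3, h4]
  module

theorem toSubspace_le_commutatorSpan_pow_two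
    (hsq : ∀ z ∈ I, F.v * z * F.v' ∈ Submodule.span ℂ (F.cornerSquares J)) :
    I.toSubspace ≤ commutatorSpan ⊤ J.toSubspace ^ 2 := by
  have hL : (commutatorSpan ⊤ J.toSubspace).IsLieStable :=
    Submodule.isLieStable_top.commutatorSpan J.isLieStable_toSubspace
  refine F.toSubspace_le hL.pow_two (fun z hz => ?_) (fun z hz => ?_)
  · refine v_mul_mul_v_mem hsq (fun h hh h1 h2 => ?_) hz
    have m3 := Submodule.mul_mem_mul
      (sub_mem_commutatorSpan hh h1) (mul_v_mem_commutatorSpan hh h1)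
    rw [pow_two]
    convert m3 using 1
    calc h * h * F.v = h * h * F.v - F.v' * h * (F.v * h) * F.v := by
          rw [v_mul_eq_zero h1]; simp
      _ = _ := by noncomm_ring
  · refine Submodule.span_le.2 ?_ (hsq z hz)
    rintro _ ⟨h, hh, h1, h2, rfl⟩
    have m3 := Submodule.mul_mem_mul
      (mul_v_mem_commutatorSpan hh h1) (v'_mul_mem_commutatorSpan hh h2)
    rw [pow_two]
    have e : h * h = h * F.v * (F.v' * h) := by
      calc h * h = h * (F.v * F.v' * h) := by rw [h1]
        _ = _ := by noncomm_ring
    rw [SetLike.mem_coe, e]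
    exact m3

end HalvingFrame

/-- This is the identity `[x, ab] = [xa, b] + [bx, a]`. -/
theorem commutatorSpan_top_le_of_le_mul {J K : TwoSidedIdeal A}
    (h : J.toSubspace ≤ K.toSubspace * K.toSubspace) :
    commutatorSpan ⊤ J.toSubspace ≤ commutatorSpan K.toSubspace K.toSubspace := by
  refine commutatorSpan_le fun x _ y hy => ?_
  refine Submodule.mul_induction_on (h hy) (fun a ha b hb => ?_) (fun a b ha hb => ?_)
  · have m1 := commutator_mem_commutatorSpan (V := K.toSubspace) (W := K.toSubspace)
      (mem_toSubspace.2 (K.mul_mem_left x _ (mem_toSubspace.1 ha))) hb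
    have m3 := commutator_mem_commutatorSpan (V := K.toSubspace) (W := K.toSubspace)
      (mem_toSubspace.2 (K.mul_mem_right b x (mem_toSubspace.1 hb))) ha
    convert add_mem m1 m3 using 1
    noncomm_ring
  · convert add_mem ha hb using 1
    noncomm_ring

theorem commutatorSpan_le_of_mul_le {J K : TwoSidedIdeal A}
    (h : K.toSubspace * K.toSubspace ≤ J.toSubspace) :
    commutatorSpan K.toSubspace K.toSubspace ≤ J.toSubspace :=
  commutatorSpan_le fun _ hx _ hy =>
    sub_mem (h (Submodule.mul_mem_mul hx hy)) (h (Submodule.mul_mem_mul hy hx))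

/-- The main theorem for abstract ideals `I`, `J = I ^ (1/2)` and `K = I ^ (1/4)`. -/
theorem HalvingFrame.commutatorSpan_identities (F : HalvingFrame A) {I J K : TwoSidedIdeal A}
    (hJ : J.toSubspace * J.toSubspace ≤ I.toSubspace)
    (hK : K.toSubspace * K.toSubspace = J.toSubspace)
    (hsq : ∀ z ∈ I, F.v * z * F.v' ∈ Submodule.span ℂ (F.cornerSquares J)) :
    I.toSubspace = commutatorSpan ⊤ J.toSubspace ^ 2 ∧
    I.toSubspace = commutatorSpan K.toSubspace K.toSubspace ^ 2 ∧
    commutatorSpan ⊤ I.toSubspace ≤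
      commutatorSpan (commutatorSpan ⊤ J.toSubspace) (commutatorSpan ⊤ J.toSubspace) ∧
    commutatorSpan (commutatorSpan ⊤ J.toSubspace) (commutatorSpan ⊤ J.toSubspace) ≤
      commutatorSpan (commutatorSpan K.toSubspace K.toSubspace)
        (commutatorSpan K.toSubspace K.toSubspace) ∧
    commutatorSpan (commutatorSpan K.toSubspace K.toSubspace)
        (commutatorSpan K.toSubspace K.toSubspace) ≤
      commutatorSpan J.toSubspace J.toSubspace := by
  have hle := commutatorSpan_top_le_of_le_mul hK.ge
  have hKJ := commutatorSpan_le_of_mul_le hK.le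
  have hI := toSubspace_le_commutatorSpan_pow_two hsq
  have hI' : commutatorSpan K.toSubspace K.toSubspace ^ 2 ≤ I.toSubspace := by
    rw [pow_two]
    exact (mul_le_mul' hKJ hKJ).trans hJ
  have hmono : commutatorSpan ⊤ J.toSubspace ^ 2 ≤
      commutatorSpan K.toSubspace K.toSubspace ^ 2 := by
    rw [pow_two, pow_two]
    exact mul_le_mul' hle hle
  exact ⟨hI.antisymm (hmono.trans hI'), (hI.trans hmono).antisymm hI',
    commutatorSpan_top_le_commutatorSpan hsq, commutatorSpan_mono hle hle,
    commutatorSpan_mono hKJ hKJ⟩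

end LieIdeals

/-! ### Ideals and their square roots in a C*-algebra with Douglas factorization and polar
decomposition. -/

section Ideals

variable {A : Type*} [CStarAlgebra A]

theorem polarization_mul (x c y : A) :
    (4 : ℂ) • (x * c * star y) = (x + y) * c * star (x + y) - (x - y) * c * star (x - y) +
      Complex.I • ((x + Complex.I • y) * c * star (x + Complex.I • y)) -
      Complex.I • ((x - Complex.I • y) * c * star (x - Complex.I • y)) := by
  simp only [star_add, star_sub, star_smul, add_mul, sub_mul, mul_add, mul_sub, smul_mul_assoc,
    mul_smul_comm, smul_add, smul_sub, smul_smul]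
  simp only [Complex.star_def, Complex.conj_I, mul_neg, Complex.I_mul_I, neg_smul, one_smul,
    neg_neg]
  module

theorem TwoSidedIdeal.smul_mem_of_mem {I : TwoSidedIdeal A} (c : ℂ) {x : A} (hx : x ∈ I) : c • x ∈ I :=
  mem_toSubspace.1 (Submodule.smul_mem _ c (mem_toSubspace.2 hx))

variable [PartialOrder A] [StarOrderedRing A]

/-- Douglas factorization: `a * a ≤ b * b` implies that `a` is a left multiple of `b`. -/
def HasDouglasFactorization (A : Type*) [CStarAlgebra A] [PartialOrder A] : Prop :=
  ∀ a b : A, star a * a ≤ star b * b → ∃ w, a = w * b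

/-- `t = w * b` is the polar decomposition of `t`: `b` is positive, and `w` is a partial isometry
with the same left and right annihilators as `t`. -/
structure IsPolarDecomposition {A : Type*} [CStarAlgebra A] [PartialOrder A] (t w b : A) :
    Prop where
  nonneg : 0 ≤ b
  partialIsometry : w * star w * w = w
  eq_mul : t = w * b
  star_mul_eq : star w * t = b
  mul_eq_zero : ∀ y, t * y = 0 → w * y = 0
  eq_zero_mul : ∀ y, y * t = 0 → y * w = 0

/-- Every element has a polar decomposition. -/
def HasPolarDecomposition (A : Type*) [CStarAlgebra A] [PartialOrder A] : Prop :=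
  ∀ t : A, ∃ w b, IsPolarDecomposition t w b

theorem CFC.star_sqrt (a : A) : star (CFC.sqrt a) = CFC.sqrt a :=
  (CFC.sqrt_nonneg a).isSelfAdjoint.star_eq

theorem CFC.star_sqrt_mul_sqrt {a : A} (ha : 0 ≤ a) : star (CFC.sqrt a) * CFC.sqrt a = a := by
  rw [CFC.star_sqrt, CFC.sqrt_mul_sqrt_self a ha]

namespace TwoSidedIdeal

variable {I : TwoSidedIdeal A}

theorem star_mem_of_hasPolarDecomposition (hP : HasPolarDecomposition A) {x : A} (hx : x ∈ I) :
    star x ∈ I := by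
  obtain ⟨w, b, h⟩ := hP x
  rw [h.eq_mul, star_mul, h.nonneg.isSelfAdjoint.star_eq]
  exact I.mul_mem_right _ _ (h.star_mul_eq ▸ I.mul_mem_left _ _ hx)

/-- Douglas factorization gives `√d = w √c`, hence `d = w c w*`. -/
theorem mem_of_nonneg_of_le (hD : HasDouglasFactorization A) {c d : A} (hd : 0 ≤ d) (hdc : d ≤ c)
    (hc : c ∈ I) : d ∈ I := by
  obtain ⟨w, hw⟩ := hD (CFC.sqrt d) (CFC.sqrt c) (by
    rwa [CFC.star_sqrt_mul_sqrt hd, CFC.star_sqrt_mul_sqrt (hd.trans hdc)])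
  have : d = w * c * star w := by
    calc d = CFC.sqrt d * star (CFC.sqrt d) := by
          rw [CFC.star_sqrt, CFC.sqrt_mul_sqrt_self d hd]
      _ = w * (CFC.sqrt c * CFC.sqrt c) * star w := by
          rw [hw, star_mul, CFC.star_sqrt]; simp only [mul_assoc]
      _ = w * c * star w := by rw [CFC.sqrt_mul_sqrt_self c (hd.trans hdc)]
  rw [this]
  exact I.mul_mem_right _ _ (I.mul_mem_left _ _ hc)

theorem toSubspace_eq_span_nonneg (hP : HasPolarDecomposition A) (I : TwoSidedIdeal A) :
    I.toSubspace = Submodule.span ℂ {b | b ∈ I ∧ 0 ≤ b} := by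
  refine le_antisymm (fun x hx => ?_) (Submodule.span_le.2 fun b hb => mem_toSubspace.2 hb.1)
  rw [mem_toSubspace] at hx
  obtain ⟨w, b, h⟩ := hP x
  have hb : b ∈ I := h.star_mul_eq ▸ I.mul_mem_left _ _ hx
  have hm : ∀ y : A, y * b * star y ∈ Submodule.span ℂ {b | b ∈ I ∧ 0 ≤ b} := fun y =>
    Submodule.subset_span ⟨I.mul_mem_right _ _ (I.mul_mem_left _ _ hb),
      star_right_conjugate_nonneg h.nonneg y⟩
  have h4 := polarization_mul w b 1
  rw [star_one, mul_one, ← h.eq_mul] at h4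
  have h5 : x = (1 / 4 : ℂ) • ((4 : ℂ) • x) := by module
  rw [h5, h4]
  exact Submodule.smul_mem _ _ (_root_.sub_mem (AddMemClass.add_mem (_root_.sub_mem (hm _) (hm _))
    (Submodule.smul_mem _ _ (hm _))) (Submodule.smul_mem _ _ (hm _)))

/-- The square root of an ideal: the ideal of all `x` with `star x * x ∈ I`. -/
def sqrtIdeal (hD : HasDouglasFactorization A) (I : TwoSidedIdeal A) : TwoSidedIdeal A :=
  TwoSidedIdeal.mk' {x | star x * x ∈ I}
    (by simp [I.zero_mem])
    (by
      intro x y hx hy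
      -- Parallelogram law: `(x + y)* (x + y) ≤ 2 (x* x + y* y)`, the difference being `(x - y)* (x
      -- - y)`.
      refine mem_of_nonneg_of_le hD (star_mul_self_nonneg _) ?_
        (I.add_mem (I.add_mem hx hy) (I.add_mem hx hy))
      rw [← sub_nonneg]
      convert star_mul_self_nonneg (x - y) using 1
      simp only [star_add, star_sub]
      noncomm_ring)
    (by intro x hx; simpa using hx)
    (by
      intro x y hy
      -- Conjugating `x* x ≤ ‖x* x‖` by `y` gives `(x y)* (x y) ≤ ‖x* x‖ y* y`.
      refine mem_of_nonneg_of_le hD (star_mul_self_nonneg _) ?_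
        (smul_mem_of_mem ((‖star x * x‖ : ℝ) : ℂ) hy)
      have h1 : star x * x ≤ algebraMap ℝ A ‖star x * x‖ :=
        IsSelfAdjoint.le_algebraMap_norm_self (IsSelfAdjoint.star_mul_self x)
      have h2 := star_left_conjugate_le_conjugate h1 y
      convert h2 using 1
      · simp only [star_mul, mul_assoc]
      · rw [← Algebra.commutes, Algebra.algebraMap_eq_smul_one]
        simp)
    (by
      intro x y hx
      change star (x * y) * (x * y) ∈ I
      rw [star_mul, mul_assoc, ← mul_assoc (star x)]
      exact I.mul_mem_left _ _ (I.mul_mem_right _ _ hx))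

variable {hD : HasDouglasFactorization A}

theorem mem_sqrtIdeal {x : A} : x ∈ sqrtIdeal hD I ↔ star x * x ∈ I := by
  rw [sqrtIdeal, TwoSidedIdeal.mem_mk']
  rfl

theorem sqrt_mem_sqrtIdeal {c : A} (h0 : 0 ≤ c) (hc : c ∈ I) : CFC.sqrt c ∈ sqrtIdeal hD I := by
  rwa [mem_sqrtIdeal, CFC.star_sqrt_mul_sqrt h0]

/-- Polarization writes `x y` as a combination of elements `z z*` with `z` in the square root;
conversely a positive `b` is `√b √b`, and such `b` span `I`. -/
theorem sqrtIdeal_mul_sqrtIdeal (hP : HasPolarDecomposition A) (I : TwoSidedIdeal A) :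
    (sqrtIdeal hD I).toSubspace * (sqrtIdeal hD I).toSubspace = I.toSubspace := by
  apply le_antisymm
  · refine Submodule.mul_le.2 fun x hx y hy => ?_
    rw [mem_toSubspace] at hx hy
    have hm : ∀ z ∈ sqrtIdeal hD I, z * 1 * star z ∈ I.toSubspace := by
      intro z hz
      have := mem_sqrtIdeal.1 (star_mem_of_hasPolarDecomposition hP hz)
      rw [star_star] at this
      rwa [mul_one, mem_toSubspace]
    have hy' := star_mem_of_hasPolarDecomposition hP hy
    have h4 := polarization_mul x 1 (star y)
    rw [star_star, mul_one] at h4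
    have h5 : x * y = (1 / 4 : ℂ) • ((4 : ℂ) • (x * y)) := by module
    rw [h5, h4]
    have hs := smul_mem_of_mem Complex.I hy'
    exact Submodule.smul_mem _ _ (_root_.sub_mem (AddMemClass.add_mem
      (_root_.sub_mem (hm _ ((sqrtIdeal hD I).add_mem hx hy'))
      (hm _ ((sqrtIdeal hD I).sub_mem hx hy'))) (Submodule.smul_mem _ _ (hm _ ((sqrtIdeal hD I).add_mem hx hs))))
      (Submodule.smul_mem _ _ (hm _ ((sqrtIdeal hD I).sub_mem hx hs))))
  · rw [toSubspace_eq_span_nonneg hP I]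
    refine Submodule.span_le.2 fun b hb => ?_
    rw [SetLike.mem_coe, ← CFC.sqrt_mul_sqrt_self b hb.2]
    have := mem_toSubspace.2 (sqrt_mem_sqrtIdeal (hD := hD) hb.2 hb.1)
    exact Submodule.mul_mem_mul this this

theorem mem_span_cornerSquares (hP : HasPolarDecomposition A) {F : HalvingFrame A}
    (hF : star F.v = F.v') {z : A} (hz : z ∈ I) :
    F.v * z * F.v' ∈ Submodule.span ℂ (F.cornerSquares (sqrtIdeal hD I)) := by
  rw [← mem_toSubspace, toSubspace_eq_span_nonneg hP] at hz
  induction hz using Submodule.span_induction with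
  | mem c hc =>
    have h0 : 0 ≤ F.v * c * F.v' := hF ▸ star_right_conjugate_nonneg hc.2 F.v
    set h := CFC.sqrt (F.v * c * F.v') with hh
    have hs : star h = h := CFC.star_sqrt _
    -- The square root stays in the corner: `h^2` annihilates `1 - p`, hence so does `h` by the
    -- C*-identity.
    have h1 : h * (1 - F.v * F.v') = 0 := by
      rw [← CStarRing.star_mul_self_eq_zero_iff, star_mul, mul_assoc, ← mul_assoc (star h),
        CFC.star_sqrt_mul_sqrt h0]
      have : F.v' * (1 - F.v * F.v') = 0 := by rw [mul_sub, F.v'_v_v', mul_one, sub_self]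
      rw [mul_assoc (F.v * c), this, mul_zero, mul_zero]
    have h2 : h * (F.v * F.v') = h := by
      rw [mul_sub, mul_one, sub_eq_zero] at h1
      exact h1.symm
    refine Submodule.subset_span ⟨h, sqrt_mem_sqrtIdeal h0
      (I.mul_mem_right _ _ (I.mul_mem_left _ _ hc.1)), ?_, h2, (CFC.sqrt_mul_sqrt_self _ h0).symm⟩
    have h3 := congr_arg star h2
    rwa [star_mul, star_mul, ← hF, star_star, hs, hF] at h3
  | zero => simp
  | add a b _ _ ha hb => rw [mul_add, add_mul]; exact AddMemClass.add_mem ha hb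
  | smul c a _ ha =>
    rw [mul_smul_comm, smul_mul_assoc]; exact Submodule.smul_mem _ c ha

end TwoSidedIdeal

end Ideals

/-! ### Factorizations and central supports in a von Neumann algebra. -/

section OperatorLemmas

variable {H : Type*} [NormedAddCommGroup H] [InnerProductSpace ℂ H] [CompleteSpace H]

namespace ContinuousLinearMap

open scoped InnerProductSpace

/-- The space is the orthogonal sum of the closure of the range of `b` and the kernel of `b*`. -/
theorem eq_zero_of_mul_eq_zero_of_star_ker {S b : H →L[ℂ] H} (h1 : S * b = 0)
    (h2 : ∀ x, star b x = 0 → S x = 0) : S = 0 := by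
  set K := (LinearMap.range (b : H →ₗ[ℂ] H)).topologicalClosure with hK
  have hKer : K ≤ LinearMap.ker (S : H →ₗ[ℂ] H) := by
    refine Submodule.topologicalClosure_minimal _ ?_ S.isClosed_ker
    rintro _ ⟨x, rfl⟩
    exact congr($h1 x)
  ext x
  have hx := K.starProjection_add_starProjection_orthogonal x
  have e1 : S (K.starProjection x) = 0 := hKer (Submodule.starProjection_apply_mem _ _)
  have e2 : S (Kᗮ.starProjection x) = 0 := by
    apply h2
    have h3 : Kᗮ = LinearMap.ker ((star b : H →L[ℂ] H) : H →ₗ[ℂ] H) := by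
      rw [hK, Submodule.orthogonal_closure]
      exact ContinuousLinearMap.orthogonal_range b
    exact h3.le (Submodule.starProjection_apply_mem Kᗮ x)
  rw [← hx, map_add, e1, e2]
  simp

/-- The contraction `b x ↦ a x` extends to the closure of the range of `b`, and by zero to its
complement. The clause on `ker b*` makes `w` unique, which later forces `w` into the von Neumann
algebra. -/
theorem exists_eq_mul_of_norm_le {a b : H →L[ℂ] H} (h : ∀ x, ‖a x‖ ≤ ‖b x‖) :
    ∃ w : H →L[ℂ] H, w * b = a ∧ ∀ x, star b x = 0 → w x = 0 := by
  set K := (LinearMap.range (b : H →ₗ[ℂ] H)).topologicalClosure with hK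
  have hmem : ∀ x, b x ∈ K := fun x => Submodule.le_topologicalClosure _ ⟨x, rfl⟩
  let e : H →ₗ[ℂ] K := (b : H →ₗ[ℂ] H).codRestrict K hmem
  have hd : DenseRange e := by
    intro y
    rw [Metric.mem_closure_range_iff]
    intro ε hε
    have hy : (y : H) ∈ closure (Set.range b) := by
      exact (Submodule.topologicalClosure_coe (LinearMap.range (b : H →ₗ[ℂ] H))).le y.2
    obtain ⟨x, hx⟩ := Metric.mem_closure_range_iff.1 hy ε hε
    exact ⟨x, hx⟩
  have hn : ∃ C, ∀ x, ‖(a : H →ₗ[ℂ] H) x‖ ≤ C * ‖e x‖ := ⟨1, fun x => by rw [one_mul]; exact h x⟩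
  refine ⟨((a : H →ₗ[ℂ] H).extendOfNorm e).comp K.orthogonalProjectionOnto, ?_, fun x hx => ?_⟩
  · ext x
    have : K.orthogonalProjectionOnto (b x) = e x :=
      Submodule.orthogonalProjectionOnto_mem_subspace_eq_self (K := K) ⟨b x, hmem x⟩
    change (a : H →ₗ[ℂ] H).extendOfNorm e (K.orthogonalProjectionOnto (b x)) = a x
    rw [this, LinearMap.extendOfNorm_eq hd hn]
    rfl
  · have : x ∈ Kᗮ := by
      rw [hK, Submodule.orthogonal_closure, ContinuousLinearMap.orthogonal_range]
      exact hx
    have h0 : K.orthogonalProjectionOnto x = 0 :=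
      Submodule.orthogonalProjectionOnto_eq_zero_iff.2 this
    rw [ContinuousLinearMap.comp_apply, h0, map_zero]

theorem norm_apply_le_of_star_mul_le {a b : H →L[ℂ] H} (h : star a * a ≤ star b * b) (x : H) :
    ‖a x‖ ≤ ‖b x‖ := by
  have h1 := ((ContinuousLinearMap.le_def _ _).1 h).inner_nonneg_right x
  have key : ∀ c : H →L[ℂ] H, ⟪x, (star c * c) x⟫_ℂ = ((‖c x‖ ^ 2 : ℝ) : ℂ) := by
    intro c
    rw [mul_apply_eq_comp, ContinuousLinearMap.star_eq_adjoint,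
      ContinuousLinearMap.adjoint_inner_right, inner_self_eq_norm_sq_to_K]
    simp
  rw [sub_apply, inner_sub_right, key, key, ← Complex.ofReal_sub,
    Complex.zero_le_real, sub_nonneg] at h1
  exact (sq_le_sq₀ (norm_nonneg _) (norm_nonneg _)).1 h1

end ContinuousLinearMap

namespace VonNeumannAlgebra

variable (M : VonNeumannAlgebra H)

theorem mem_of_forall_commutant {x : H →L[ℂ] H} (h : ∀ g ∈ M.commutant, g * x = x * g) :
    x ∈ M.toStarSubalgebra := by
  change x ∈ M
  rwa [← M.commutant_commutant, mem_commutant_iff]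

theorem commutant_mul_comm {g x : H →L[ℂ] H} (hg : g ∈ M.commutant)
    (hx : x ∈ M.toStarSubalgebra) : g * x = x * g :=
  (mem_commutant_iff.1 hg x hx).symm

theorem isClosed_toStarSubalgebra : IsClosed (M.toStarSubalgebra : Set (H →L[ℂ] H)) := by
  rw [M.coe_toStarSubalgebra, ← M.centralizer_centralizer]
  exact Set.isClosed_centralizer _

instance : CompleteSpace M.toStarSubalgebra := M.isClosed_toStarSubalgebra.completeSpace_coe

noncomputable instance : CStarAlgebra M.toStarSubalgebra where

theorem coe_nonneg_iff {x : M.toStarSubalgebra} : 0 ≤ (x : H →L[ℂ] H) ↔ 0 ≤ x := Iff.rfl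

instance : StarOrderedRing M.toStarSubalgebra := by
  refine StarOrderedRing.of_nonneg_iff' (fun {x y} hxy z => ?_) fun x => ⟨fun hx => ?_, ?_⟩
  · exact add_le_add_right (α := H →L[ℂ] H) hxy z
  · refine ⟨⟨(x : H →L[ℂ] H) ^ (1 / 2 : ℝ), M.rpow_mem_toStarSubalgebra x.2 _⟩, ?_⟩
    apply Subtype.ext
    change (x : H →L[ℂ] H) = star ((x : H →L[ℂ] H) ^ (1 / 2 : ℝ)) * (x : H →L[ℂ] H) ^ (1 / 2 : ℝ)
    rw [← CFC.sqrt_eq_rpow, CFC.star_sqrt_mul_sqrt (M.coe_nonneg_iff.2 hx)]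
  · rintro ⟨s, rfl⟩
    exact star_mul_self_nonneg (s : H →L[ℂ] H)

theorem coe_sqrt (x : M.toStarSubalgebra) (hx : 0 ≤ x) :
    ((CFC.sqrt x : M.toStarSubalgebra) : H →L[ℂ] H) = (x : H →L[ℂ] H) ^ (1 / 2 : ℝ) := by
  rw [← CFC.sqrt_eq_rpow]
  symm
  have h0 : 0 ≤ ((CFC.sqrt x : M.toStarSubalgebra) : H →L[ℂ] H) := CFC.sqrt_nonneg x
  refine CFC.sqrt_unique ?_ h0
  exact congr_arg Subtype.val (CFC.sqrt_mul_sqrt_self x hx)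

variable {M}

/-- For `g` in the commutant, `g w - w g` vanishes on the range of `b` and on `ker b*`, so the
double commutant theorem applies. -/
theorem mem_of_mul_eq {w a b : H →L[ℂ] H} (ha : a ∈ M.toStarSubalgebra)
    (hb : b ∈ M.toStarSubalgebra) (hw : w * b = a) (hw' : ∀ x, star b x = 0 → w x = 0) :
    w ∈ M.toStarSubalgebra := by
  refine M.mem_of_forall_commutant fun g hg => ?_
  rw [← sub_eq_zero]
  refine ContinuousLinearMap.eq_zero_of_mul_eq_zero_of_star_ker (b := b) ?_ fun x hx => ?_
  · rw [sub_mul, mul_assoc, hw, mul_assoc, M.commutant_mul_comm hg hb, ← mul_assoc, hw,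
      M.commutant_mul_comm hg ha, sub_self]
  · have h1 : star b (g x) = 0 := by
      have := congr($(M.commutant_mul_comm hg (star_mem hb)) x)
      rw [mul_apply_eq_comp, hx, map_zero] at this
      exact this.symm
    simp [hw' _ hx, hw' _ h1]

theorem hasDouglasFactorization : HasDouglasFactorization M.toStarSubalgebra := by
  intro a b hab
  obtain ⟨w, h1, h2⟩ := ContinuousLinearMap.exists_eq_mul_of_norm_le
    (ContinuousLinearMap.norm_apply_le_of_star_mul_le (a := (a : H →L[ℂ] H)) hab)
  exact ⟨⟨w, mem_of_mul_eq a.2 b.2 h1 h2⟩, Subtype.ext h1.symm⟩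

theorem eq_zero_of_mul_eq_zero_of_star {S b : M.toStarSubalgebra} (h1 : S * b = 0)
    (h2 : ∀ x, star (b : H →L[ℂ] H) x = 0 → (S : H →L[ℂ] H) x = 0) : S = 0 :=
  Subtype.ext <| ContinuousLinearMap.eq_zero_of_mul_eq_zero_of_star_ker
    (congr_arg Subtype.val h1) h2

theorem hasPolarDecomposition : HasPolarDecomposition M.toStarSubalgebra := by
  intro t
  set b := CFC.sqrt (star t * t) with hb
  have hbb : star b * b = star t * t := CFC.star_sqrt_mul_sqrt (star_mul_self_nonneg t)
  have hs : star b = b := CFC.star_sqrt _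
  obtain ⟨w', h1, h2⟩ := ContinuousLinearMap.exists_eq_mul_of_norm_le
    (ContinuousLinearMap.norm_apply_le_of_star_mul_le (a := (t : H →L[ℂ] H)) (b := b)
      (congr_arg Subtype.val hbb).ge)
  obtain ⟨w, rfl⟩ : ∃ w : M.toStarSubalgebra, (w : H →L[ℂ] H) = w' :=
    ⟨⟨w', mem_of_mul_eq t.2 b.2 h1 h2⟩, rfl⟩
  have h3 : w * b = t := Subtype.ext h1
  have hsb : star (b : H →L[ℂ] H) = b := congr_arg Subtype.val hs
  have h4 : star w * w * b = b := by
    rw [← sub_eq_zero]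
    -- The adjoint is used because the vanishing criterion tests an operator on the range of `b` and
    -- on `ker b`.
    have hz : star (star w * w * b - b) = 0 := by
      refine eq_zero_of_mul_eq_zero_of_star (b := b) ?_ fun x hx => ?_
      · rw [star_sub, sub_mul, star_mul, star_mul, star_star, hs, mul_assoc, mul_assoc, h3,
          ← mul_assoc, ← hs, ← star_mul, h3, hs, ← hbb, hs, sub_self]
      · have : star (star w * w * b - b) = b * star w * w - b := by
          simp only [star_sub, star_mul, star_star, hs, mul_assoc]
        rw [this]
        have hw := h2 x hx
        rw [hsb] at hx
        simp [hw, hx]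
    exact star_eq_zero.1 hz
  refine ⟨w, b, CFC.sqrt_nonneg _, ?_, h3.symm, ?_, fun y hy => ?_, fun y hy => ?_⟩
  · rw [← sub_eq_zero]
    refine eq_zero_of_mul_eq_zero_of_star (b := b) ?_ fun x hx => ?_
    · rw [sub_mul, mul_assoc, mul_assoc, ← mul_assoc (star w), h4, sub_self]
    · simp [h2 x hx]
  · rw [← h3, ← mul_assoc, h4]
  · have hby : b * y = 0 := by
      rw [← CStarRing.star_mul_self_eq_zero_iff, star_mul, mul_assoc, ← mul_assoc (star b), hbb,
        mul_assoc, hy, mul_zero, mul_zero]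
    apply Subtype.ext
    ext x
    refine h2 _ ?_
    rw [hsb]
    exact congr(($hby : H →L[ℂ] H) x)
  · refine eq_zero_of_mul_eq_zero_of_star (b := b) ?_ fun x hx => ?_
    · rw [mul_assoc, h3, hy]
    · simp [h2 x hx]

/-- Every projection has a central support. -/
theorem exists_central_support (e : M.toStarSubalgebra) :
    ∃ z : M.toStarSubalgebra, IsStarProjection z ∧ (∀ x, z * x = x * z) ∧ e * z = e ∧
      ∀ y, (∀ x, e * x * y = 0) → z * y = 0 := by
  -- `N` is the common kernel of all `e x` with `x ∈ M`. It is invariant under both `M` and its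
  -- commutant, so its projection is central; the central support is the complement.
  let N : Submodule ℂ H :=
    { carrier := {ξ | ∀ x : M.toStarSubalgebra, (e : H →L[ℂ] H) ((x : H →L[ℂ] H) ξ) = 0}
      add_mem' := fun {a b} ha hb x => by simp [ha x, hb x]
      zero_mem' := fun x => by simp
      smul_mem' := fun c a ha x => by simp [ha x] }
  have hNc : IsClosed (N : Set H) := by
    have : (N : Set H) = ⋂ x : M.toStarSubalgebra,
        {ξ | (e : H →L[ℂ] H) ((x : H →L[ℂ] H) ξ) = 0} := by
      ext ξ; simp [N]
    rw [this]
    exact isClosed_iInter fun x => isClosed_eq (by fun_prop) continuous_const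
  have : CompleteSpace N := hNc.completeSpace_coe
  have hNx : ∀ x : M.toStarSubalgebra, ∀ ξ ∈ N, (x : H →L[ℂ] H) ξ ∈ N := by
    intro x ξ hξ y
    exact hξ (y * x)
  have hNg : ∀ g ∈ M.commutant, ∀ ξ ∈ N, g ξ ∈ N := by
    intro g hg ξ hξ y
    have h1 := congr($(M.commutant_mul_comm hg y.2) ξ)
    have h2 := congr($(M.commutant_mul_comm hg e.2) ((y : H →L[ℂ] H) ξ))
    simp only [mul_apply_eq_comp] at h1 h2
    rw [← h1, ← h2, hξ y, map_zero]
  have hP := isStarProjection_starProjection (U := N)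
  have hrange : (N.starProjection : H →ₗ[ℂ] H).range = N := by simp
  have hmem : N.starProjection ∈ M := by
    rw [IsStarProjection.mem_iff hP]
    intro g hg
    rw [hrange]
    exact fun ξ hξ => hNg g hg ξ hξ
  have hmem' : N.starProjection ∈ M.commutant := by
    rw [IsStarProjection.mem_iff hP, M.commutant_commutant]
    intro g hg
    rw [hrange]
    exact fun ξ hξ => hNx ⟨g, hg⟩ ξ hξ
  let z' : M.toStarSubalgebra := ⟨N.starProjection, hmem⟩
  have hz' : IsStarProjection z' :=
    ⟨Subtype.ext hP.isIdempotentElem, Subtype.ext hP.isSelfAdjoint⟩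
  have hmemN : ∀ ξ, N.starProjection ξ ∈ N := Submodule.starProjection_apply_mem N
  refine ⟨1 - z', hz'.one_sub, fun x => ?_, ?_, fun y hy => ?_⟩
  · have : z' * x = x * z' := Subtype.ext (M.commutant_mul_comm hmem' x.2)
    rw [sub_mul, mul_sub, this, one_mul, mul_one]
  · have : e * z' = 0 := by
      apply Subtype.ext
      ext ξ
      exact hmemN ξ 1
    rw [mul_sub, this, mul_one, sub_zero]
  · have : z' * y = y := by
      apply Subtype.ext
      ext ξ
      refine Submodule.starProjection_eq_self_iff.2 fun x => ?_
      exact congr(($(hy x) : H →L[ℂ] H) ξ)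
    rw [sub_mul, this, one_mul, sub_self]

end VonNeumannAlgebra

end OperatorLemmas

/-! ### Weak operator limits along ultrafilters. -/

section WeakLimits

variable {H : Type*} [NormedAddCommGroup H] [InnerProductSpace ℂ H] [CompleteSpace H]

open Filter Topology
open scoped InnerProductSpace ComplexConjugate

/-- Each matrix coefficient stays in a compact disc, so it converges along the ultrafilter; the
limits form a bounded sesquilinear form, which is represented by an operator. -/
theorem exists_weak_limit {ι : Type*} (𝒰 : Ultrafilter ι) (v : ι → H →L[ℂ] H)
    (hv : ∀ i, ‖v i‖ ≤ 1) :
    ∃ w : H →L[ℂ] H, ∀ ξ η, Tendsto (fun i => ⟪v i ξ, η⟫_ℂ) 𝒰 (𝓝 ⟪w ξ, η⟫_ℂ) := by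
  have hb : ∀ ξ η i, ‖⟪v i ξ, η⟫_ℂ‖ ≤ ‖ξ‖ * ‖η‖ := fun ξ η i =>
    (norm_inner_le_norm _ _).trans (mul_le_mul_of_nonneg_right
      (((v i).le_opNorm ξ).trans (mul_le_of_le_one_left (norm_nonneg _) (hv i))) (norm_nonneg _))
  have hlim : ∀ ξ η, ∃ c : ℂ, ‖c‖ ≤ ‖ξ‖ * ‖η‖ ∧ Tendsto (fun i => ⟪v i ξ, η⟫_ℂ) 𝒰 (𝓝 c) := by
    intro ξ η
    obtain ⟨c, hc, h⟩ := (isCompact_closedBall (0 : ℂ) (‖ξ‖ * ‖η‖)).ultrafilter_le_nhds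
      (𝒰.map fun i => ⟪v i ξ, η⟫_ℂ) (by
        rw [le_principal_iff]
        exact Filter.mem_map.2 (univ_mem' fun i => by simpa using hb ξ η i))
    exact ⟨c, by simpa using hc, h⟩
  choose B hB hBt using hlim
  have huniq : ∀ ξ η c, Tendsto (fun i => ⟪v i ξ, η⟫_ℂ) 𝒰 (𝓝 c) → B ξ η = c :=
    fun ξ η c h => tendsto_nhds_unique (hBt ξ η) h
  let B' : H →ₗ⋆[ℂ] H →ₗ[ℂ] ℂ := LinearMap.mk₂'ₛₗ (starRingEnd ℂ) (RingHom.id ℂ) B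
    (fun a b c => huniq _ _ _ (by
      simpa [inner_add_left] using (hBt a c).add (hBt b c)))
    (fun r a c => huniq _ _ _ (by
      simpa [inner_smul_left, mul_comm] using (hBt a c).mul_const (conj r)))
    (fun a b c => huniq _ _ _ (by
      simpa [inner_add_right] using (hBt a b).add (hBt a c)))
    (fun r a c => huniq _ _ _ (by
      simpa [inner_smul_right] using (hBt a c).const_mul r))
  refine ⟨InnerProductSpace.continuousLinearMapOfBilin
    (B'.mkContinuous₂ 1 fun x y => by simpa [B'] using hB x y), fun ξ η => ?_⟩
  rw [InnerProductSpace.continuousLinearMapOfBilin_apply]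
  exact hBt ξ η

namespace VonNeumannAlgebra

variable {M : VonNeumannAlgebra H}

/-- Relations affine in `v i` survive weak limits, and all relations needed later have the shape `a
v b = c v d + e`. Commutation with the commutant is one of them, so the limit lies in `M`. -/
theorem exists_weak_limit {ι : Type*} (𝒰 : Ultrafilter ι) (v : ι → M.toStarSubalgebra)
    (hv : ∀ i, ‖v i‖ ≤ 1) :
    ∃ w : M.toStarSubalgebra, ∀ a b c d e : M.toStarSubalgebra,
      (∀ᶠ i in 𝒰, a * v i * b = c * v i * d + e) → a * w * b = c * w * d + e := by
  obtain ⟨w, hw⟩ := _root_.exists_weak_limit 𝒰 (fun i => (v i : H →L[ℂ] H)) hv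
  have key : ∀ a b c d e : H →L[ℂ] H,
      (∀ᶠ i in 𝒰, a * (v i : H →L[ℂ] H) * b = c * (v i : H →L[ℂ] H) * d + e) →
        a * w * b = c * w * d + e := by
    intro a b c d e h
    ext ξ
    refine ext_inner_right ℂ fun η => ?_
    have hl : ∀ a b : H →L[ℂ] H, Tendsto (fun i => ⟪(a * (v i : H →L[ℂ] H) * b) ξ, η⟫_ℂ) 𝒰
        (𝓝 ⟪(a * w * b) ξ, η⟫_ℂ) := by
      intro a b
      have := hw (b ξ) (star a η)
      simp only [ContinuousLinearMap.star_eq_adjoint,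
        ContinuousLinearMap.adjoint_inner_right] at this
      exact this
    refine tendsto_nhds_unique (hl a b) ?_
    rw [add_apply, inner_add_left]
    refine ((hl c d).add_const _).congr' ?_
    filter_upwards [h] with i hi
    rw [hi, add_apply, inner_add_left]
  have hwM : w ∈ M.toStarSubalgebra := by
    refine M.mem_of_forall_commutant fun g hg => ?_
    have := key g 1 1 g 0 (Eventually.of_forall fun i => by
      simpa using M.commutant_mul_comm hg (v i).2)
    simpa using this
  exact ⟨⟨w, hwM⟩, fun a b c d e h => Subtype.ext (key a b c d e
    (h.mono fun i hi => congr_arg Subtype.val hi))⟩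

end VonNeumannAlgebra

end WeakLimits

/-! ### Maximal partial isometries of square zero. -/

section PartialIsometries

theorem norm_le_one_of_partialIsometry {A : Type*} [NormedRing A] [StarRing A] [CStarRing A] {v : A}
    (hv : v * star v * v = v) : ‖v‖ ≤ 1 := by
  have h1 : ‖v‖ * ‖v‖ = ‖star v * v‖ := (CStarRing.norm_star_mul_self).symm
  have h2 : star (star v * v) * (star v * v) = star v * v := by
    rw [star_mul, star_star, mul_assoc, ← mul_assoc v, hv]
  have h3 : ‖star v * v‖ * ‖star v * v‖ = ‖star v * v‖ := by
    rw [← CStarRing.norm_star_mul_self, h2]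
  rw [← h1] at h3
  by_contra! h
  have h4 : 1 < ‖v‖ * ‖v‖ := one_lt_mul_of_lt_of_le h h.le
  nlinarith

/-- A partial isometry `v = f * v * e` with `v * v = 0`. -/
structure IsNilpotentPartialIsometry {A : Type*} [Ring A] [StarRing A] (f e v : A) : Prop where
  partialIsometry : v * star v * v = v
  mul_self : v * v = 0
  left : f * v = v
  right : v * e = v

variable {H : Type*} [NormedAddCommGroup H] [InnerProductSpace ℂ H] [CompleteSpace H]
  {M : VonNeumannAlgebra H}

theorem star_mul_mul_star_of_partialIsometry {A : Type*} [Ring A] [StarRing A] {v : A}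
    (hv : v * star v * v = v) : star v * v * star v = star v := by
  simpa only [star_mul, star_star, mul_assoc] using congr_arg star hv

theorem star_mul_eq_of_extends {A : Type*} [Ring A] [StarRing A] {v w : A}
    (hv : v * star v * v = v) (h : v * (star v * w) = v) : star v * w = star v * v := by
  rw [← star_mul_mul_star_of_partialIsometry hv, mul_assoc, mul_assoc, h, mul_assoc _ (star v),
    mul_assoc, ← mul_assoc v, hv]

theorem mul_star_eq_of_extends {A : Type*} [Ring A] [StarRing A] {v w : A}
    (hv : v * star v * v = v) (h : w * (star v * v) = v) : w * star v = v * star v := by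
  rw [← star_mul_mul_star_of_partialIsometry hv, ← mul_assoc, h, ← mul_assoc, ← mul_assoc, hv]

/-- The type of nilpotent partial isometries `v = f * v * e`. -/
structure NilpotentPartialIsometry {A : Type*} [Ring A] [StarRing A] (f e : A) where
  /-- The partial isometry. -/
  val : A
  prop : IsNilpotentPartialIsometry f e val

/-- Nilpotent partial isometries are ordered by extension. -/
instance {A : Type*} [Ring A] [StarRing A] (f e : A) :
    Preorder (NilpotentPartialIsometry f e) where
  -- The two conditions say that `w` agrees with `v` on the initial space of `v`, and `w*` with `v*`
  -- on its final space.
  le v w := w.1 * (star v.1 * v.1) = v.1 ∧ v.1 * (star v.1 * w.1) = v.1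
  le_refl v := by
    have := v.2.partialIsometry
    rw [mul_assoc] at this
    exact ⟨this, this⟩
  le_trans := by
    rintro ⟨v, hv⟩ ⟨w, hw⟩ ⟨x, hx⟩ ⟨h1, h2⟩ ⟨h3, h4⟩
    dsimp only at *
    have a1 : star v * w = star v * v := star_mul_eq_of_extends hv.partialIsometry h2
    have a2 : w * star v = v * star v := mul_star_eq_of_extends hv.partialIsometry h1
    have a3 : star w * v = star v * v := by
      have := congr_arg star a1
      simpa only [star_mul, star_star] using this
    have a4 : v * star w = v * star v := by
      have := congr_arg star a2
      simpa only [star_mul, star_star] using this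
    constructor
    · calc x * (star v * v) = x * (star w * (w * (star v * v))) := by rw [h1, a3]
        _ = x * (star w * w) * (star v * v) := by simp only [mul_assoc]
        _ = v := by rw [h3, h1]
    · calc v * (star v * x) = v * star v * x := (mul_assoc _ _ _).symm
        _ = v * star v * v * star w * x := by rw [hv.partialIsometry, a4]
        _ = v * (star v * w) * star w * x := by rw [a1, ← mul_assoc]
        _ = v * star v * (w * (star w * x)) := by simp only [mul_assoc]
        _ = v := by rw [h4, mul_assoc, h2]

theorem IsNilpotentPartialIsometry.add {A : Type*} [Ring A] [StarRing A] {f e v w : A}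
    (hv : IsNilpotentPartialIsometry f e v) (hw : IsNilpotentPartialIsometry f e w)
    (h1 : star v * w = 0) (h2 : v * star w = 0) (h3 : v * w = 0) (h4 : w * v = 0) :
    IsNilpotentPartialIsometry f e (v + w) := by
  have h1' : star w * v = 0 := by simpa using congr_arg star h1
  have h2' : w * star v = 0 := by simpa using congr_arg star h2
  have a1 := hv.partialIsometry
  have a2 := hw.partialIsometry
  refine ⟨?_, ?_, ?_, ?_⟩
  · simp only [star_add, add_mul, mul_add, h2, h2', a1, a2, add_zero, zero_add]
    simp [mul_assoc, h1, h1']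
  · simp [add_mul, mul_add, h3, h4, hv.mul_self, hw.mul_self]
  · rw [mul_add, hv.left, hw.left]
  · rw [add_mul, hv.right, hw.right]

namespace VonNeumannAlgebra

open Filter in
-- By Zorn's lemma: a chain is bounded by a weak limit `w` of its members. Maximality is recorded as
-- the absence of a nonzero `w` orthogonal to `v`, since otherwise `v + w` would extend `v`.
theorem exists_maximal_nilpotentPartialIsometry (f e : M.toStarSubalgebra) :
    ∃ v, IsNilpotentPartialIsometry f e v ∧ ∀ w, IsNilpotentPartialIsometry f e w →
      star v * w = 0 → v * star w = 0 → v * w = 0 → w * v = 0 → w = 0 := by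
  have : Nonempty (NilpotentPartialIsometry f e) :=
    ⟨⟨0, ⟨by simp, by simp, by simp, by simp⟩⟩⟩
  obtain ⟨⟨v, hv⟩, hmax⟩ := zorn_le_nonempty
    (α := NilpotentPartialIsometry f e) (by
      intro c hc hne
      have hnec : Nonempty c := hne.to_subtype
      have hdir : IsDirectedOrder c := ⟨fun a b => by
        rcases hc.total a.2 b.2 with h | h
        · exact ⟨b, h, le_refl b⟩
        · exact ⟨a, le_refl a, h⟩⟩
      obtain ⟨w, hw⟩ := exists_weak_limit (Ultrafilter.of (atTop : Filter c))
        (fun i => i.1.1) (fun i => norm_le_one_of_partialIsometry i.1.2.partialIsometry)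
      have hev : ∀ i : c, ∀ᶠ j in (Ultrafilter.of (atTop : Filter c)), i ≤ j := fun i =>
        (Ultrafilter.of_le (atTop : Filter c)) (eventually_ge_atTop i)
      -- Quadratic relations are not weakly continuous, so one factor is kept fixed at index `i`
      -- while `j` tends to the limit; the remaining factor is sent to the limit afterwards.
      have p1 : ∀ i : c, w * (star i.1.1 * i.1.1) = i.1.1 := by
        intro i
        have := hw 1 (star i.1.1 * i.1.1) 0 0 i.1.1 ((hev i).mono fun j hj => by
          simpa using hj.1)
        simpa using this
      have p2 : ∀ i : c, star i.1.1 * w = star i.1.1 * i.1.1 := by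
        intro i
        have := hw (star i.1.1) 1 0 0 (star i.1.1 * i.1.1) ((hev i).mono fun j hj => by
          simpa using star_mul_eq_of_extends i.1.2.partialIsometry hj.2)
        simpa using this
      have p3 : ∀ i : c, i.1.1 * w = 0 := by
        intro i
        have := hw i.1.1 1 0 0 0 ((hev i).mono fun j hj => by
          have h1 : i.1.1 * star j.1.1 = i.1.1 * star i.1.1 := by
            simpa using congr_arg star (mul_star_eq_of_extends i.1.2.partialIsometry hj.1)
          have h2 : i.1.1 * star j.1.1 * j.1.1 = i.1.1 := by
            rw [h1, mul_assoc]; exact hj.2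
          have h3 : i.1.1 * j.1.1 = 0 := by
            rw [← h2, mul_assoc, j.1.2.mul_self, mul_zero]
          simpa using h3)
        simpa using this
      refine ⟨⟨w, ?_, ?_, ?_, ?_⟩, ?_⟩
      · have p4 : ∀ i : c, w * star w * i.1.1 = i.1.1 := by
          intro i
          have := congr_arg star (p2 i)
          simp only [star_mul, star_star] at this
          rw [mul_assoc, this, p1 i]
        have := hw (w * star w) 1 1 1 0 (Eventually.of_forall fun i => by simpa using p4 i)
        simpa using this
      · have := hw 1 w 0 0 0 (Eventually.of_forall fun i => by simpa using p3 i)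
        simpa using this
      · have := hw f 1 1 1 0 (Eventually.of_forall fun i => by simpa using i.1.2.left)
        simpa using this
      · have := hw 1 e 1 1 0 (Eventually.of_forall fun i => by simpa using i.1.2.right)
        simpa using this
      · intro a ha
        refine ⟨p1 ⟨a, ha⟩, ?_⟩
        rw [p2 ⟨a, ha⟩, ← mul_assoc]
        exact a.2.partialIsometry)
  refine ⟨v, hv, fun w hw h1 h2 h3 h4 => ?_⟩
  have h1' : star w * v = 0 := by simpa using congr_arg star h1
  have h2' : w * star v = 0 := by simpa using congr_arg star h2
  have hle : (⟨v, hv⟩ : NilpotentPartialIsometry f e) ≤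
      ⟨v + w, hv.add hw h1 h2 h3 h4⟩ := by
    constructor
    · change (v + w) * (star v * v) = v
      rw [add_mul, ← mul_assoc, ← mul_assoc, h2', hv.partialIsometry, zero_mul, add_zero]
    · change v * (star v * (v + w)) = v
      rw [mul_add, h1, add_zero, ← mul_assoc, hv.partialIsometry]
  have h5 : v * (star (v + w) * (v + w)) = v + w := (hmax hle).1
  have h6 : v * (star (v + w) * (v + w)) = v := by
    rw [← mul_assoc, star_add, mul_add v, h2, add_zero, mul_add, hv.partialIsometry, mul_assoc, h1,
      mul_zero, add_zero]
  rw [h6] at h5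
  exact (left_eq_add.1 h5)

end VonNeumannAlgebra

end PartialIsometries

/-! ### A central summand without square-zero elements is commutative. -/

section Reduced

variable {A : Type*} [CStarAlgebra A]

/-- Both `z e x (1 - e)` and `z (1 - e) x e` have square zero, hence vanish. -/
theorem mul_mul_eq_of_isStarProjection {z : A} (hc : ∀ x, z * x = x * z)
    (hred : ∀ t, z * t = t → t * t = 0 → t = 0) (hzz : z * z = z) {e : A} (he : e * e = e) (x : A) :
    z * (e * x) = z * (x * e) := by
  have h1 : z * (e * x * (1 - e)) = 0 := by
    refine hred _ (by rw [← mul_assoc, hzz]) ?_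
    calc z * (e * x * (1 - e)) * (z * (e * x * (1 - e)))
        = z * (e * x * ((1 - e) * z) * (e * x * (1 - e))) := by simp only [mul_assoc]
      _ = z * (e * x * z * ((e - e * e) * (x * (1 - e)))) := by rw [← hc]; noncomm_ring
      _ = 0 := by rw [he]; simp
  have h2 : z * ((1 - e) * x * e) = 0 := by
    refine hred _ (by rw [← mul_assoc, hzz]) ?_
    calc z * ((1 - e) * x * e) * (z * ((1 - e) * x * e))
        = z * ((1 - e) * x * (e * z) * ((1 - e) * x * e)) := by simp only [mul_assoc]
      _ = z * ((1 - e) * x * z * ((e - e * e) * (x * e))) := by rw [← hc]; noncomm_ring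
      _ = 0 := by rw [he]; simp
  rw [← sub_eq_zero]
  calc z * (e * x) - z * (x * e) = z * (e * x * (1 - e)) - z * ((1 - e) * x * e) := by noncomm_ring
    _ = 0 := by rw [h1, h2, sub_zero]

variable [PartialOrder A]

theorem exists_support_projection (hP : HasPolarDecomposition A) {b : A} (hb : IsSelfAdjoint b) :
    ∃ e : A, IsStarProjection e ∧ e * b = b ∧ ∀ y, b * y = 0 → e * y = 0 := by
  obtain ⟨w, c, h⟩ := hP b
  refine ⟨w * star w, ⟨?_, IsSelfAdjoint.mul_star_self w⟩, ?_, fun y hy => ?_⟩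
  · change w * star w * (w * star w) = w * star w
    rw [← mul_assoc, h.partialIsometry]
  · rw [h.eq_mul, ← mul_assoc, h.partialIsometry]
  · have h1 : star y * b = 0 := by simpa [hb.star_eq] using congr_arg star hy
    have h2 : star w * y = 0 := by simpa using congr_arg star (h.eq_zero_mul _ h1)
    rw [mul_assoc, h2, mul_zero]

/-- Every condition on `t` is an annihilation relation, and `w` has the annihilators of `t`. -/
theorem IsPolarDecomposition.isNilpotentPartialIsometry {f e t w b : A}
    (h : IsPolarDecomposition t w b) (ht : t * t = 0) (hf : f * t = t) (he : t * e = t) :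
    IsNilpotentPartialIsometry f e w where
  partialIsometry := h.partialIsometry
  mul_self := h.mul_eq_zero _ (h.eq_zero_mul _ ht)
  left := by
    have := h.eq_zero_mul (1 - f) (by rw [sub_mul, one_mul, hf, sub_self])
    rw [sub_mul, one_mul, sub_eq_zero] at this
    exact this.symm
  right := by
    have := h.mul_eq_zero (1 - e) (by rw [mul_sub, mul_one, he, sub_self])
    rw [mul_sub, mul_one, sub_eq_zero] at this
    exact this.symm

variable [StarOrderedRing A]

/-- A step of the dyadic expansion of `a` as a series of projections. -/
theorem exists_projection_two_nsmul_sub (hP : HasPolarDecomposition A) {a : A} (h0 : 0 ≤ a)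
    (h1 : a ≤ 1) : ∃ e : A, IsStarProjection e ∧ 0 ≤ 2 • a - e ∧ 2 • a - e ≤ 1 := by
  have hs : IsSelfAdjoint (2 • a - 1 : A) := by
    rw [two_nsmul]
    exact (h0.isSelfAdjoint.add h0.isSelfAdjoint).sub (.one A)
  set s := 2 • a - 1 with hsdef
  have hsub : s⁺ - s⁻ = s := CFC.posPart_sub_negPart s hs
  have hps : IsSelfAdjoint s⁺ := (CFC.posPart_nonneg s).isSelfAdjoint
  have hns : IsSelfAdjoint s⁻ := (CFC.negPart_nonneg s).isSelfAdjoint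
  -- `e` is the support of the positive part of `s = 2a - 1`. Both bounds follow from `2a - e = s⁺ +
  -- (1 - e) 2a (1 - e)` and `1 - (2a - e) = s⁻ + e 2(1 - a) e`.
  obtain ⟨e, he, e1, e2⟩ := exists_support_projection hP hps
  have hes : star e = e := he.isSelfAdjoint.star_eq
  have hee : e * e = e := he.isIdempotentElem
  have e3 : e * s⁻ = 0 := e2 _ (CFC.posPart_mul_negPart s)
  have e4 : s⁺ * e = s⁺ := by simpa [hes, hps.star_eq] using congr_arg star e1
  have e5 : s⁻ * e = 0 := by simpa [hes, hns.star_eq] using congr_arg star e3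
  have e6 : e * s = s⁺ := by
    calc e * s = e * (s⁺ - s⁻) := by rw [hsub]
      _ = s⁺ := by rw [mul_sub, e1, e3, sub_zero]
  have h2a : 2 • a = s + 1 := by rw [hsdef]; abel
  refine ⟨e, he, ?_, ?_⟩
  · have hc := star_left_conjugate_nonneg (nsmul_nonneg h0 2) (1 - e)
    have : 2 • a - e = s⁺ + star (1 - e) * (2 • a) * (1 - e) := by
      rw [star_sub, star_one, hes, h2a]
      have : (1 - e) * (s + 1) * (1 - e) = s - e * s - (s - e * s) * e + (1 - e - e + e * e) := by
        noncomm_ring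
      rw [this, e6, hee]
      have : s - s⁺ = -s⁻ := by nth_rw 1 [← hsub]; abel
      rw [this, neg_mul, e5]
      nth_rw 1 [← hsub]
      abel
    rw [this]
    exact add_nonneg (CFC.posPart_nonneg s) hc
  · have hc := star_left_conjugate_nonneg (nsmul_nonneg (sub_nonneg.2 h1) 2) e
    rw [← sub_nonneg]
    have : 1 - (2 • a - e) = s⁻ + star e * (2 • (1 - a)) * e := by
      rw [hes, smul_sub, h2a]
      have : e * (2 • 1 - (s + 1)) * e = e * e - e * s * e := by
        noncomm_ring
      rw [this, e6, e4, hee]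
      nth_rw 1 [← hsub]
      abel
    rw [this]
    exact add_nonneg (CFC.negPart_nonneg s) hc

variable {z : A}

/-- Since `z [e, x] = 0`, replacing `a` by `2a - e` doubles `z [a, x]` while staying between `0` and
`1`, where the trivial bound on the commutator holds. -/
theorem two_pow_mul_norm_commutator_le (hP : HasPolarDecomposition A) (hc : ∀ x, z * x = x * z)
    (hred : ∀ t, z * t = t → t * t = 0 → t = 0) (hzz : z * z = z) (x : A) (n : ℕ) :
    ∀ a : A, 0 ≤ a → a ≤ 1 → 2 ^ n * ‖z * (a * x - x * a)‖ ≤ ‖z‖ * (‖x‖ + ‖x‖) := by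
  induction n with
  | zero =>
    intro a h0 h1
    have ha : ‖a‖ ≤ 1 := CStarAlgebra.norm_le_one_iff_of_nonneg a |>.2 h1
    rw [pow_zero, one_mul]
    refine (norm_mul_le _ _).trans (mul_le_mul_of_nonneg_left ?_ (norm_nonneg _))
    refine (norm_sub_le _ _).trans (add_le_add ?_ ?_)
    · exact (norm_mul_le _ _).trans (mul_le_of_le_one_left (norm_nonneg _) ha)
    · exact (norm_mul_le _ _).trans (mul_le_of_le_one_right (norm_nonneg _) ha)
  | succ n ih =>
    intro a h0 h1
    obtain ⟨e, he, h2, h3⟩ := exists_projection_two_nsmul_sub hP h0 h1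
    have h4 := mul_mul_eq_of_isStarProjection hc hred hzz he.isIdempotentElem x
    have h5 : z * ((2 • a - e) * x - x * (2 • a - e)) = (2 : ℝ) • (z * (a * x - x * a)) := by
      calc z * ((2 • a - e) * x - x * (2 • a - e))
          = 2 • (z * (a * x - x * a)) - (z * (e * x) - z * (x * e)) := by noncomm_ring
        _ = _ := by rw [h4, sub_self, sub_zero, two_smul, two_smul]
    have h6 := ih _ h2 h3
    rw [h5, norm_smul, Real.norm_ofNat] at h6
    calc 2 ^ (n + 1) * ‖z * (a * x - x * a)‖ = 2 ^ n * (2 * ‖z * (a * x - x * a)‖) := by ring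
      _ ≤ _ := h6

theorem mul_comm_of_no_square_zero (hP : HasPolarDecomposition A) (hc : ∀ x, z * x = x * z)
    (hred : ∀ t, z * t = t → t * t = 0 → t = 0) (hzz : z * z = z) (a x : A) :
    z * (a * x - x * a) = 0 := by
  have ha : a ∈ Submodule.span ℂ {a : A | 0 ≤ a} := by
    rw [CStarAlgebra.span_nonneg]; exact Submodule.mem_top
  induction ha using Submodule.span_induction with
  | mem a ha =>
    have ha : 0 ≤ a := ha
    -- This factor scales `a` into the interval from `0` to `1`; the added `1` avoids division by
    -- zero.
    set r : ℝ := (‖a‖ + 1)⁻¹ with hr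
    have hpos : 0 < ‖a‖ + 1 := by positivity
    have hr0 : 0 < r := inv_pos.2 hpos
    have h0 : 0 ≤ r • a := smul_nonneg hr0.le ha
    have h1 : r • a ≤ 1 := by
      rw [← CStarAlgebra.norm_le_one_iff_of_nonneg (r • a), norm_smul, Real.norm_of_nonneg hr0.le,
        hr, inv_mul_le_one₀ hpos]
      linarith
    have h2 : z * ((r • a) * x - x * (r • a)) = r • (z * (a * x - x * a)) := by
      simp only [smul_mul_assoc, mul_smul_comm, smul_sub, mul_sub]
    have h3 : z * ((r • a) * x - x * (r • a)) = 0 := by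
      by_contra hne
      have hn := norm_pos_iff.2 hne
      obtain ⟨n, hn'⟩ := pow_unbounded_of_one_lt (‖z‖ * (‖x‖ + ‖x‖) /
        ‖z * ((r • a) * x - x * (r • a))‖) (one_lt_two : (1 : ℝ) < 2)
      rw [div_lt_iff₀ hn] at hn'
      exact absurd (two_pow_mul_norm_commutator_le hP hc hred hzz x n _ h0 h1) hn'.not_ge
    rw [h2] at h3
    exact (smul_eq_zero.1 h3).resolve_left hr0.ne'
  | zero => simp
  | add a b _ _ ha hb =>
    calc z * ((a + b) * x - x * (a + b)) = z * (a * x - x * a) + z * (b * x - x * b) := by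
          noncomm_ring
      _ = 0 := by rw [ha, hb, add_zero]
  | smul c a _ ha =>
    calc z * (c • a * x - x * c • a) = c • (z * (a * x - x * a)) := by
          simp only [smul_mul_assoc, mul_smul_comm, smul_sub, mul_sub]
      _ = 0 := by rw [ha, smul_zero]

end Reduced

/-! ### Construction of the halving frame. -/

namespace VonNeumannAlgebra

variable {H : Type*} [NormedAddCommGroup H] [InnerProductSpace ℂ H] [CompleteSpace H]
  {M : VonNeumannAlgebra H}

/-- A partial isometry `v` with `v * v = 0`, such that the corner of `1 - v v* - v* v` is
reduced. -/
theorem exists_partialIsometry_reduced_corner (M : VonNeumannAlgebra H) :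
    ∃ v : M.toStarSubalgebra, v * star v * v = v ∧ v * v = 0 ∧
      ∀ t, (1 - v * star v - star v * v) * t = t → t * (1 - v * star v - star v * v) = t →
        t * t = 0 → t = 0 := by
  obtain ⟨v, hv, hmax⟩ := M.exists_maximal_nilpotentPartialIsometry 1 1
  refine ⟨v, hv.partialIsometry, hv.mul_self, fun t h1 h2 h3 => ?_⟩
  set r := 1 - v * star v - star v * v with hr
  have a1 := hv.partialIsometry
  have a2 := star_mul_mul_star_of_partialIsometry a1
  have a3 := hv.mul_self
  have a4 : star v * star v = 0 := by simpa using congr_arg star a3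
  have v_r : v * r = 0 := by
    rw [hr, mul_sub, mul_sub, mul_one, ← mul_assoc, ← mul_assoc, a3, a1, zero_mul]; simp
  have r_v : r * v = 0 := by
    rw [hr, sub_mul, sub_mul, one_mul, mul_assoc (star v), a3, a1, mul_zero]; simp
  have v'_r : star v * r = 0 := by
    rw [hr, mul_sub, mul_sub, mul_one, ← mul_assoc, ← mul_assoc, a4, a2, zero_mul]; simp
  obtain ⟨w, b, hw⟩ := hasPolarDecomposition t
  have hn := hw.isNilpotentPartialIsometry h3 h1 h2
  -- The polar part of `t` lives in the corner of `r`, hence is orthogonal to `v` on both sides, and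
  -- maximality of `v` kills it.
  have hw0 : w = 0 := by
    have hrs : star r = r := by simp [hr]
    have h4 : r * star w = star w := by simpa [hrs] using congr_arg star hn.right
    refine hmax w ⟨hn.partialIsometry, hn.mul_self, one_mul w, mul_one w⟩ ?_ ?_ ?_ ?_
    · rw [← hn.left, ← mul_assoc, v'_r, zero_mul]
    · rw [← h4, ← mul_assoc, v_r, zero_mul]
    · rw [← hn.left, ← mul_assoc, v_r, zero_mul]
    · rw [← hn.right, mul_assoc, r_v, mul_zero]
  rw [hw.eq_mul, hw0, zero_mul]

/-- Take `u` maximal from `r` into `p`; square zero is automatic from `r p = 0`. A nonzero `(p - u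
u*) x (r - u* u)` would have a polar part by which `u` could be extended. -/
theorem exists_partialIsometry_between {p r : M.toStarSubalgebra} (hp : IsStarProjection p)
    (hr : IsStarProjection r) (hrp : r * p = 0) :
    ∃ u : M.toStarSubalgebra, u * star u * u = u ∧ p * u = u ∧ u * r = u ∧
      ∀ x, (p - u * star u) * x * (r - star u * u) = 0 := by
  obtain ⟨u, hu, hmax⟩ := M.exists_maximal_nilpotentPartialIsometry p r
  refine ⟨u, hu.partialIsometry, hu.left, hu.right, fun x => ?_⟩
  have hps : star p = p := hp.isSelfAdjoint.star_eq
  have hrs : star r = r := hr.isSelfAdjoint.star_eq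
  have hpp : p * p = p := hp.isIdempotentElem
  have hrr : r * r = r := hr.isIdempotentElem
  have a1 := hu.partialIsometry
  have a2 := star_mul_mul_star_of_partialIsometry a1
  have u'_p : star u * p = star u := by simpa [hps] using congr_arg star hu.left
  have r_u : r * u = 0 := by rw [← hu.left, ← mul_assoc, hrp, zero_mul]
  have u_p : u * p = 0 := by rw [← hu.right, mul_assoc, hrp, mul_zero]
  set p' := p - u * star u with hp'
  set r' := r - star u * u with hr'
  have p_p' : p * p' = p' := by rw [hp', mul_sub, hpp, ← mul_assoc, hu.left]
  have r'_r : r' * r = r' := by rw [hr', sub_mul, hrr, mul_assoc, hu.right]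
  have u'_p' : star u * p' = 0 := by rw [hp', mul_sub, u'_p, ← mul_assoc, a2, sub_self]
  have u_r' : u * r' = 0 := by rw [hr', mul_sub, hu.right, ← mul_assoc, a1, sub_self]
  have p'_p' : p' * p' = p' := by
    nth_rw 1 [hp']
    rw [sub_mul, p_p', mul_assoc, u'_p', mul_zero, sub_zero]
  have r'_r' : r' * r' = r' := by
    nth_rw 2 [hr']
    rw [mul_sub, r'_r]
    have : r' * star u = 0 := by
      have h := congr_arg star u_r'
      simpa [hr', hrs] using h
    rw [← mul_assoc, this, zero_mul, sub_zero]
  have r'_p' : r' * p' = 0 := by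
    rw [hr', hp', mul_sub, sub_mul, sub_mul, hrp, mul_assoc, u_p, ← mul_assoc, r_u,
      mul_assoc (star u), ← mul_assoc u, hu.mul_self]
    simp
  obtain ⟨w, b, hw⟩ := hasPolarDecomposition (p' * x * r')
  have hn := hw.isNilpotentPartialIsometry (f := p') (e := r')
    (by
      calc p' * x * r' * (p' * x * r') = p' * x * (r' * p') * (x * r') := by simp only [mul_assoc]
        _ = 0 := by rw [r'_p']; simp)
    (by rw [← mul_assoc, ← mul_assoc, p'_p']) (by rw [mul_assoc, r'_r'])
  have hw0 : w = 0 := by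
    have hr's : star r' = r' := by simp [hr', hrs]
    have h4 : r' * star w = star w := by simpa [hr's] using congr_arg star hn.right
    have h5 : p * w = w := by rw [← hn.left, ← mul_assoc, p_p']
    have h6 : w * r = w := by rw [← hn.right, mul_assoc, r'_r]
    refine hmax w ⟨hn.partialIsometry, hn.mul_self, h5, h6⟩ ?_ ?_ ?_ ?_
    · rw [← hn.left, ← mul_assoc, u'_p', zero_mul]
    · rw [← h4, ← mul_assoc, u_r', zero_mul]
    · rw [← h5, ← mul_assoc, u_p, zero_mul]
    · rw [← h6, mul_assoc, r_u, mul_zero]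
  rw [hw.eq_mul, hw0, zero_mul]

/-- If the corner of the projection `r` is reduced and `1 - r` is disjoint from a projection `e`,
then `e` vanishes, provided there is no commutative summand. -/
theorem ZeroCommutativeSummand.eq_zero_of_reduced_corner (hM : M.ZeroCommutativeSummand)
    {r e : M.toStarSubalgebra}
    (hred : ∀ t, r * t = t → t * r = t → t * t = 0 → t = 0)
    (he : ∀ x, e * x * (1 - r) = 0) : e = 0 := by
  obtain ⟨z, hz, hc, hez, h⟩ := exists_central_support e
  have hzz : z * z = z := hz.isIdempotentElem
  -- The central support of `e` lies below `r`, so the summand `zM` inherits the absence of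
  -- square-zero elements and is commutative.
  have hzr : z * r = z := by
    have := h (1 - r) he
    rw [mul_sub, mul_one, sub_eq_zero] at this
    exact this.symm
  have hcomm := mul_comm_of_no_square_zero (z := z) hasPolarDecomposition hc
    (fun t h1 h2 => hred t (by rw [← h1, ← mul_assoc, ← hc, hzr])
      (by rw [← h1, hc, mul_assoc, hzr]) h2) hzz
  have hz0 : z = 0 := by
    refine hM z hz hc fun x y => ?_
    have h1 := hcomm x y
    rw [mul_sub, sub_eq_zero] at h1
    calc z * x * (z * y) = z * (x * z) * y := by simp only [mul_assoc]
      _ = z * (x * y) := by rw [← hc, ← mul_assoc, hzz, mul_assoc]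
      _ = z * (y * x) := h1
      _ = z * (y * z) * x := by rw [← hc, ← mul_assoc, ← mul_assoc, hzz]
      _ = z * y * (z * x) := by simp only [mul_assoc]
  rw [← hez, hz0, mul_zero]

theorem ZeroCommutativeSummand.exists_halvingFrame (hM : M.ZeroCommutativeSummand) :
    ∃ F : HalvingFrame M.toStarSubalgebra, star F.v = F.v' := by
  obtain ⟨v, a1, a3, hred⟩ := M.exists_partialIsometry_reduced_corner
  have a2 := star_mul_mul_star_of_partialIsometry a1
  have a4 : star v * star v = 0 := by simpa using congr_arg star a3
  set r := 1 - v * star v - star v * v with hr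
  have v_r : v * r = 0 := by
    rw [hr, mul_sub, mul_sub, mul_one, ← mul_assoc, ← mul_assoc, a3, a1, zero_mul]; simp
  have r_v : r * v = 0 := by
    rw [hr, sub_mul, sub_mul, one_mul, mul_assoc (star v), a3, a1, mul_zero]; simp
  have hrs : star r = r := by simp [hr]
  have r_v' : r * star v = 0 := by simpa [hrs] using congr_arg star v_r
  have hrr : r * r = r := by
    nth_rw 2 [hr]
    rw [mul_sub, mul_sub, ← mul_assoc, ← mul_assoc, r_v, r_v']; simp
  have hp : IsStarProjection (v * star v) :=
    ⟨by change v * star v * (v * star v) = _; rw [← mul_assoc, a1], IsSelfAdjoint.mul_star_self v⟩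
  obtain ⟨u, b1, b2, b3, hu⟩ := exists_partialIsometry_between hp ⟨hrr, hrs⟩
    (by rw [← mul_assoc, r_v, zero_mul])
  have b4 := star_mul_mul_star_of_partialIsometry b1
  set r' := r - star u * u with hr'
  have hr's : star r' = r' := by simp [hr', hrs]
  have r_u' : r * star u = star u := by simpa [hrs] using congr_arg star b3
  have r_r' : r * r' = r' := by rw [hr', mul_sub, hrr, ← mul_assoc, r_u']
  have r'_r : r' * r = r' := by simpa [hrs, hr's] using congr_arg star r_r'
  have r'_u' : r' * star u = 0 := by rw [hr', sub_mul, r_u', b4, sub_self]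
  -- This element lies in the corner of `r` and has square zero because `r' u* = 0`. With `hu` it
  -- follows that `p`, then the equivalent `q`, and so `1 - r`, are disjoint from `r'`.
  have c1 : ∀ x, star u * x * r' = 0 := fun x => by
    refine hred _ (by rw [← mul_assoc, ← mul_assoc, r_u']) (by rw [mul_assoc, r'_r]) ?_
    calc star u * x * r' * (star u * x * r') = star u * x * (r' * star u) * (x * r') := by
          simp only [mul_assoc]
      _ = 0 := by rw [r'_u']; simp
  have c2 : ∀ x, v * star v * x * r' = 0 := fun x => by
    calc v * star v * x * r' = (v * star v - u * star u) * x * r' + u * (star u * x * r') := by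
          noncomm_ring
      _ = 0 := by rw [hu, c1, mul_zero, add_zero]
  have c3 : ∀ x, star v * v * x * r' = 0 := fun x => by
    calc star v * v * x * r' = star v * (v * star v * (v * x) * r') := by
          nth_rw 1 [← a2]; simp only [mul_assoc]
      _ = 0 := by rw [c2, mul_zero]
  have hr'0 : r' = 0 := by
    refine hM.eq_zero_of_reduced_corner hred fun x => ?_
    have h1 : (1 - r) * star x * r' = 0 := by
      calc (1 - r) * star x * r' = v * star v * star x * r' + star v * v * star x * r' := by
            rw [hr]; noncomm_ring
        _ = 0 := by rw [c2, c3, add_zero]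
    simpa [hrs, hr's, mul_assoc] using congr_arg star h1
  have hru : star u * u = r := (sub_eq_zero.1 hr'0).symm
  have v_u : v * u = 0 := by rw [← b2, ← mul_assoc, ← mul_assoc, a3, zero_mul, zero_mul]
  have u_v : u * v = 0 := by rw [← b3, mul_assoc, r_v, mul_zero]
  have u_v' : u * star v = 0 := by rw [← b3, mul_assoc, r_v', mul_zero]
  have u_u : u * u = 0 := by
    nth_rw 2 [← b2]
    rw [mul_assoc, ← mul_assoc, u_v, zero_mul]
  exact ⟨{ v := v, v' := star v, u := u, u' := star u
           v_v := a3
           v'_v' := a4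
           v_u := v_u
           u_v := u_v
           u_v' := u_v'
           u'_v' := by simpa using congr_arg star v_u
           v_u' := by simpa using congr_arg star u_v'
           v'_u' := by simpa using congr_arg star u_v
           u_u := u_u
           u'_u' := by simpa using congr_arg star u_u
           v_v'_v := by rw [← mul_assoc, a1]
           v'_v_v' := by rw [← mul_assoc, a2]
           v_v'_u := by rw [← mul_assoc, b2]
           u'_v_v' := by simpa using congr_arg star b2
           u_u'_u := by rw [← mul_assoc, b1]
           u'_u_u' := by rw [← mul_assoc, b4]
           sum_eq_one := by rw [hru, hr]; abel }, rfl⟩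

/-! ### Identification of `I^{1/2}` and `I^{1/4}` with iterated square roots, and the conclusion. -/

open TwoSidedIdeal

/-- A positive `b` lies in the square root exactly when `b^2 ∈ I`, that is, when `b` is the square
root of a positive element of `I`. -/
theorem idealPow_half (I : TwoSidedIdeal M.toStarSubalgebra) :
    M.idealPow I (1 / 2) = (sqrtIdeal hasDouglasFactorization I).toSubspace := by
  refine (M.eq_idealPow_of_positive_part I _ _
    (toSubspace_eq_span_nonneg hasPolarDecomposition _) fun b => ⟨?_, ?_⟩).symm
  · rintro ⟨hb, h0⟩
    have h0 : 0 ≤ b := h0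
    rw [mem_sqrtIdeal, h0.isSelfAdjoint.star_eq] at hb
    have h1 : 0 ≤ b * b := by
      have := star_mul_self_nonneg b
      rwa [h0.isSelfAdjoint.star_eq] at this
    exact ⟨b * b, hb, h1, by rw [← M.coe_sqrt _ h1, CFC.sqrt_mul_self b h0]⟩
  · rintro ⟨a, ha, h0, hb⟩
    have h0 : 0 ≤ a := h0
    rw [← M.coe_sqrt _ h0] at hb
    obtain rfl : b = CFC.sqrt a := Subtype.ext hb
    exact ⟨sqrt_mem_sqrtIdeal h0 ha, CFC.sqrt_nonneg a⟩

theorem idealPow_quarter (I : TwoSidedIdeal M.toStarSubalgebra) :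
    M.idealPow I (1 / 4) = (sqrtIdeal hasDouglasFactorization
      (sqrtIdeal hasDouglasFactorization I)).toSubspace := by
  have hpow : ∀ a : M.toStarSubalgebra, 0 ≤ a →
      ((CFC.sqrt (CFC.sqrt a) : M.toStarSubalgebra) : H →L[ℂ] H) =
        (a : H →L[ℂ] H) ^ (1 / 4 : ℝ) := by
    intro a h0
    rw [M.coe_sqrt _ (CFC.sqrt_nonneg a), M.coe_sqrt _ h0,
      CFC.rpow_rpow_of_exponent_nonneg _ _ _ (by norm_num) (by norm_num) (M.coe_nonneg_iff.2 h0)]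
    norm_num
  refine (M.eq_idealPow_of_positive_part I _ _
    (toSubspace_eq_span_nonneg hasPolarDecomposition _) fun b => ⟨?_, ?_⟩).symm
  · rintro ⟨hb, h0⟩
    have h0 : 0 ≤ b := h0
    have h1 : 0 ≤ b * b := by
      have := star_mul_self_nonneg b
      rwa [h0.isSelfAdjoint.star_eq] at this
    have h2 : 0 ≤ b * b * (b * b) := by
      have := star_mul_self_nonneg (b * b)
      rwa [h1.isSelfAdjoint.star_eq] at this
    rw [mem_sqrtIdeal, mem_sqrtIdeal, h0.isSelfAdjoint.star_eq, h1.isSelfAdjoint.star_eq] at hb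
    exact ⟨_, hb, h2, by
      rw [← hpow _ h2, CFC.sqrt_mul_self (b * b) h1, CFC.sqrt_mul_self b h0]⟩
  · rintro ⟨a, ha, h0, hb⟩
    have h0 : 0 ≤ a := h0
    rw [← hpow _ h0] at hb
    obtain rfl : b = CFC.sqrt (CFC.sqrt a) := Subtype.ext hb
    exact ⟨sqrt_mem_sqrtIdeal (CFC.sqrt_nonneg a) (sqrt_mem_sqrtIdeal h0 ha),
      CFC.sqrt_nonneg (CFC.sqrt a)⟩

end VonNeumannAlgebra

theorem mainTheorem8 {H : Type*} [NormedAddCommGroup H] [InnerProductSpace ℂ H] [CompleteSpace H]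
    (M : VonNeumannAlgebra H) (hM : M.ZeroCommutativeSummand)
    (I : TwoSidedIdeal M.toStarSubalgebra) :
    I.toSubspace = commutatorSpan ⊤ (M.idealPow I (1 / 2)) ^ 2 ∧
    I.toSubspace = commutatorSpan (M.idealPow I (1 / 4)) (M.idealPow I (1 / 4)) ^ 2 ∧
    commutatorSpan ⊤ I.toSubspace ≤
      commutatorSpan (commutatorSpan ⊤ (M.idealPow I (1 / 2)))
        (commutatorSpan ⊤ (M.idealPow I (1 / 2))) ∧
    commutatorSpan (commutatorSpan ⊤ (M.idealPow I (1 / 2)))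
        (commutatorSpan ⊤ (M.idealPow I (1 / 2))) ≤
      commutatorSpan (commutatorSpan (M.idealPow I (1 / 4)) (M.idealPow I (1 / 4)))
        (commutatorSpan (M.idealPow I (1 / 4)) (M.idealPow I (1 / 4))) ∧
    commutatorSpan (commutatorSpan (M.idealPow I (1 / 4)) (M.idealPow I (1 / 4)))
        (commutatorSpan (M.idealPow I (1 / 4)) (M.idealPow I (1 / 4))) ≤
      commutatorSpan (M.idealPow I (1 / 2)) (M.idealPow I (1 / 2)) := by

  obtain ⟨F, hF⟩ := hM.exists_halvingFrame
  rw [VonNeumannAlgebra.idealPow_half, VonNeumannAlgebra.idealPow_quarter]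
  exact F.commutatorSpan_identities
    (TwoSidedIdeal.sqrtIdeal_mul_sqrtIdeal VonNeumannAlgebra.hasPolarDecomposition _).le
    (TwoSidedIdeal.sqrtIdeal_mul_sqrtIdeal VonNeumannAlgebra.hasPolarDecomposition _)
    fun _ hz => TwoSidedIdeal.mem_span_cornerSquares VonNeumannAlgebra.hasPolarDecomposition hF hz
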